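/- Let $k$ be a field of characteristic zero and let $G\subseteq \mathrm{GL}_2(k)$ be a reductive algebraic subgroup (not necessarily connected) which is not cyclic. Let $\operatorname{Aut}(\mathbb{A}^2_k)$ be the group of polynomial automorphisms of the affine plane, let $\operatorname{Aut}^G(\mathbb{A}^2_k)$ be its subgroup of automorphisms commuting with every $g\in G$, and let $\mathrm{GL}_2^G(k)=\mathrm{GL}_2(k)\cap\operatorname{Aut}^G(\mathbb{A}^2_k)$. Then one of the following holds. (1) $\operatorname{Aut}^G(\mathbb{A}^2_k)=\mathrm{GL}_2^G(k)$. (2) $G\cong k^*$, and there is an integer $v\ge 2$ such that, after some linear change of coordinates, $$G=\{(z_1,z_2)\mapsto(\lambda^v z_1,\lambda z_2):\lambda\in k^*\}$$ and $$\operatorname{Aut}^G(\mathbb{A}^2_k)=\{(z_1,z_2)\mapsto(\alpha_1z_1+\beta z_2^v,\ \alpha_2z_2):\alpha_1,\alpha_2\in k^*,\ \beta\in k\}.$$ (3) $G\cong k^*$ and, after some linear change of coordinates, $G=\{(z_1,z_2)\mapsto(z_1,\lambda z_2):\lambda\in k^*\}$ and $\operatorname{Aut}^G(\mathbb{A}^2_k)=\{(z_1,z_2)\mapsto(\alpha_1z_1+\beta,\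 \alpha_2z_2):\alpha_1,\alpha_2\in k^*,\ \beta\in k\}$. In particular, if $k=\mathbb{C}$, then $\mathrm{Aut}_{\mathrm{alg}}^G(\mathbb{C}^2)=\operatorname{Aut}^G(\mathbb{A}^2_{\mathbb{C}})$, with the topology of locally uniform convergence of automorphisms and their inverses, is a connected complex Lie group, for a complex structure with respect to which it acts holomorphically on $\mathbb{C}^2$. -/

import Mathlib

open scoped MatrixGroups Manifold ContDiff

/-- A self-map of `kⁿ` whose components are given by polynomials. -/
def IsPolynomialMap {k : Type*} [CommRing k] {n : ℕ} (f : (Fin n → k) → (Fin n → k)) : Prop :=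
  ∃ p : Fin n → MvPolynomial (Fin n) k, ∀ z i, f z i = MvPolynomial.eval z (p i)

theorem IsPolynomialMap.id {k : Type*} [CommRing k] {n : ℕ} :
    IsPolynomialMap (fun z : Fin n → k => z) :=
  ⟨fun i => MvPolynomial.X i, fun z i => by simp⟩

theorem IsPolynomialMap.comp {k : Type*} [CommRing k] {n : ℕ}
    {f g : (Fin n → k) → (Fin n → k)} (hf : IsPolynomialMap f) (hg : IsPolynomialMap g) :
    IsPolynomialMap (fun z => f (g z)) := by
  obtain ⟨p, hp⟩ := hf
  obtain ⟨q, hq⟩ := hg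
  refine ⟨fun i => MvPolynomial.bind₁ q (p i), fun z i => ?_⟩
  have h : g z = fun j => MvPolynomial.eval z (q j) := funext (hq z)
  change f (g z) i = _
  rw [hp, h]
  change _ = (MvPolynomial.eval₂Hom (RingHom.id k) z) (MvPolynomial.bind₁ q (p i))
  rw [MvPolynomial.eval₂Hom_bind₁]
  rfl

theorem IsPolynomialMap.continuous {n : ℕ} {f : (Fin n → ℂ) → (Fin n → ℂ)}
    (hf : IsPolynomialMap f) : Continuous f := by
  obtain ⟨p, hp⟩ := hf
  refine continuous_pi fun i => ?_
  simp only [hp]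
  exact (p i).continuous_eval

/-- The group of polynomial automorphisms of affine `n`-space over a field `k`: the polynomial
bijections of `kⁿ` with polynomial inverse, under composition. It is used for infinite `k` only,
where polynomials and polynomial functions are the same. -/
def polyAut (k : Type*) [Field k] (n : ℕ) : Subgroup (Equiv.Perm (Fin n → k)) where
  carrier := {φ | IsPolynomialMap φ ∧ IsPolynomialMap φ.symm}
  one_mem' := ⟨IsPolynomialMap.id, IsPolynomialMap.id⟩
  mul_mem' := fun ha hb => ⟨ha.1.comp hb.1, hb.2.comp ha.2⟩
  inv_mem' := fun ha => ⟨ha.2, ha.1⟩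

/-- `GLₙ(k)` acting on `kⁿ` by linear maps. -/
def linearPerm (k : Type*) [Field k] (n : ℕ) : GL (Fin n) k →* Equiv.Perm (Fin n → k) where
  toFun g :=
    { toFun := fun z => (g : Matrix (Fin n) (Fin n) k).mulVec z
      invFun := fun z => ((g⁻¹ : GL (Fin n) k) : Matrix (Fin n) (Fin n) k).mulVec z
      left_inv := fun z => by simp only [Matrix.mulVec_mulVec, Units.inv_mul, Matrix.one_mulVec]
      right_inv := fun z => by simp only [Matrix.mulVec_mulVec, Units.mul_inv, Matrix.one_mulVec] }
  map_one' := by ext1 z; exact Matrix.one_mulVec z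
  map_mul' := fun g h => by
    ext1 z
    exact (Matrix.mulVec_mulVec z (g : Matrix (Fin n) (Fin n) k) (h : Matrix (Fin n) (Fin n) k)).symm

/-- `Aut^G`: the polynomial automorphisms of affine `n`-space that commute with every `g ∈ G`. -/
def equivariantAut {k : Type*} [Field k] {n : ℕ} (G : Subgroup (GL (Fin n) k)) :
    Subgroup (Equiv.Perm (Fin n → k)) :=
  polyAut k n ⊓ Subgroup.centralizer (G.map (linearPerm k n) : Set (Equiv.Perm (Fin n → k)))

/-- `GLₙ^G`: the linear automorphisms in `Aut^G`. -/
def equivariantGL {k : Type*} [Field k] {n : ℕ} (G : Subgroup (GL (Fin n) k)) :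
    Subgroup (Equiv.Perm (Fin n → k)) :=
  (linearPerm k n).range ⊓ equivariantAut G

/-- Zariski closed subsets of `GLₙ(k)`: the sets cut out by polynomials in the matrix entries. -/
def IsZariskiClosed {k : Type*} [Field k] {n : ℕ} (S : Set (GL (Fin n) k)) : Prop :=
  ∃ I : Set (MvPolynomial (Fin n × Fin n) k), ∀ g : GL (Fin n) k,
    g ∈ S ↔ ∀ p ∈ I, MvPolynomial.eval (fun ij => (g : Matrix (Fin n) (Fin n) k) ij.1 ij.2) p = 0

/-- A (not necessarily connected) reductive subgroup of `GLₙ(k)`, for `k` of characteristic zero: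
an algebraic subgroup without nontrivial normal unipotent algebraic subgroups. In characteristic
zero unipotent algebraic groups are connected and the unipotent radical is defined over `k` and has
a dense set of `k`-points, so that this says that the unipotent radical is trivial. -/
structure IsReductive {k : Type*} [Field k] {n : ℕ} (G : Subgroup (GL (Fin n) k)) : Prop where
  closed : IsZariskiClosed (G : Set (GL (Fin n) k))
  unipotent : ∀ U : Subgroup (GL (Fin n) k), U ≤ G → IsZariskiClosed (U : Set (GL (Fin n) k)) →
    (∀ g ∈ G, ∀ u ∈ U, g * u * g⁻¹ ∈ U) →
    (∀ u ∈ U, IsNilpotent ((u : Matrix (Fin n) (Fin n) k) - 1)) → U = ⊥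

/-- `G ≅ k^*` and, after some linear change of coordinates `P`, `G` consists of the maps
`(λ ^ v z₁, λ z₂)` and `Aut^G` consists of the maps `(α₁ z₁ + β z₂ ^ v, α₂ z₂)`. -/
def IsWeightedTorus {k : Type*} [Field k] (G : Subgroup (GL (Fin 2) k)) (v : ℕ) : Prop :=
  Nonempty (G ≃* kˣ) ∧ ∃ P : GL (Fin 2) k,
    (∀ g : GL (Fin 2) k, g ∈ G.map (MulAut.conj P).toMonoidHom ↔
      ∃ l : kˣ, (g : Matrix (Fin 2) (Fin 2) k) = !![(l : k) ^ v, 0; 0, (l : k)]) ∧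
    (∀ φ : Equiv.Perm (Fin 2 → k),
      φ ∈ (equivariantAut G).map (MulAut.conj (linearPerm k 2 P)).toMonoidHom ↔
      ∃ (a₁ a₂ : kˣ) (b : k), ∀ z, φ z = ![(a₁ : k) * z 0 + b * z 1 ^ v, (a₂ : k) * z 1])

/-- `Aut_alg^G(ℂⁿ)` as a type. -/
def AutAlgG {n : ℕ} (G : Subgroup (GL (Fin n) ℂ)) : Type := ↥(equivariantAut G)

noncomputable instance {n : ℕ} (G : Subgroup (GL (Fin n) ℂ)) : Group (AutAlgG G) :=
  inferInstanceAs (Group ↥(equivariantAut G))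

/-- An automorphism together with its inverse, as continuous maps. -/
noncomputable def AutAlgG.toContinuousMaps {n : ℕ} (G : Subgroup (GL (Fin n) ℂ)) (φ : AutAlgG G) :
    C(Fin n → ℂ, Fin n → ℂ) × C(Fin n → ℂ, Fin n → ℂ) :=
  (⟨φ.1, φ.2.1.1.continuous⟩, ⟨φ.1.symm, φ.2.1.2.continuous⟩)

/-- The topology of locally uniform convergence of automorphisms and of their inverses. -/
noncomputable instance {n : ℕ} (G : Subgroup (GL (Fin n) ℂ)) : TopologicalSpace (AutAlgG G) :=
  TopologicalSpace.induced (AutAlgG.toContinuousMaps G) inferInstance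

/-- `Aut_alg^G(ℂⁿ)`, with the topology above, is a connected (finite-dimensional, complex) Lie
group, with a complex structure for which it acts holomorphically on `ℂⁿ`, that is, for which the
inclusion into the automorphisms of `ℂⁿ` is a holomorphic map. -/
def IsConnectedLieGroup {n : ℕ} (G : Subgroup (GL (Fin n) ℂ)) : Prop :=
  ∃ (d : ℕ) (_ : ChartedSpace (EuclideanSpace ℂ (Fin d)) (AutAlgG G)),
    LieGroup 𝓘(ℂ, EuclideanSpace ℂ (Fin d)) ω (AutAlgG G) ∧
    T2Space (AutAlgG G) ∧ SecondCountableTopology (AutAlgG G) ∧ ConnectedSpace (AutAlgG G) ∧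
    ContMDiff (𝓘(ℂ, EuclideanSpace ℂ (Fin d)).prod 𝓘(ℂ, Fin n → ℂ)) 𝓘(ℂ, Fin n → ℂ) ω
      (fun x : AutAlgG G × (Fin n → ℂ) => x.1.1 x.2)

/-! Suppose some `φ` in `Aut^G` is not linear. Since `G` acts linearly, each homogeneous component
of `φ` is again equivariant. Either the constant term is nonzero, or the top part has degree `D ≥
2`. In the second case `φ` has a polynomial left inverse, whose leading form must vanish on the top
part of `φ`, so the two components of that part are proportional. Either way one gets an equivariant
map `h · w` with `h` a form of degree `d ≠ 1` and `w` a nonzero vector: `w` is a common eigenvector,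
and `h` is semi-invariant with the same character (`exists_semiinvariant_form`).

The elements of `G` that fix `w` and have determinant one form a normal closed unipotent subgroup,
which reductivity kills. Hence `G` is commutative. If some element has two distinct eigenvalues, its
second eigenline is `G`-stable. Otherwise each element is `c (1 + N)` with `N² = 0`; semi-invariance
gives `c ^ d = c`, a power of the element is unipotent, and `N = 0`. So `G` is diagonalizable over
`k` itself (`IsReductive.exists_eigenbasis`).

For diagonal `G`, if the `i`th character is not a power of the other one, then the `i`th component
of an equivariant automorphism is a multiple of `z i`. As `φ` is not linear, up to a swap `G` lies
in the torus of the `(l ^ v, l)`. A proper closed subgroup of this torus is finite, hence cyclic, so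
`G` is the whole torus; `v = 1` is impossible because maps commuting with all scalars are linear.
Comparing weights of monomials then gives `Aut^G`. The value `v = 0` is case (3), where `z₂ ^ 0 = 1`
makes the shear a translation.

Over `ℂ`, the values at finitely many points give one global linear coordinate on `Aut^G`, whose
image is the complement of a quadric in a vector space: open, and connected because complex lines
minus finitely many points are. -/

/-! ### Linear maps, equivariance and change of coordinates. -/

open MvPolynomial in
theorem isPolynomialMap_mulVec {k : Type*} [CommRing k] {n : ℕ} (M : Matrix (Fin n) (Fin n) k) :
    IsPolynomialMap (fun z => M.mulVec z) :=
  ⟨fun i => ∑ j, C (M i j) * X j, fun z i => by simp [Matrix.mulVec, dotProduct]⟩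

theorem linearPerm_apply {k : Type*} [Field k] {n : ℕ} (g : GL (Fin n) k) (z : Fin n → k) :
    linearPerm k n g z = (g : Matrix (Fin n) (Fin n) k).mulVec z := rfl

theorem linearPerm_mem_polyAut {k : Type*} [Field k] {n : ℕ} (g : GL (Fin n) k) :
    linearPerm k n g ∈ polyAut k n :=
  ⟨isPolynomialMap_mulVec _, isPolynomialMap_mulVec _⟩

theorem mem_equivariantAut_iff {k : Type*} [Field k] {n : ℕ} {G : Subgroup (GL (Fin n) k)}
    {φ : Equiv.Perm (Fin n → k)} :
    φ ∈ equivariantAut G ↔ (IsPolynomialMap φ ∧ IsPolynomialMap φ.symm) ∧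
      ∀ g ∈ G, ∀ z, φ ((g : Matrix (Fin n) (Fin n) k).mulVec z) =
        (g : Matrix (Fin n) (Fin n) k).mulVec (φ z) := by
  refine Subgroup.mem_inf.trans (and_congr Iff.rfl ?_)
  rw [Subgroup.mem_centralizer_iff]
  constructor
  · intro h g hg z
    exact (congrArg (fun e : Equiv.Perm (Fin n → k) => e z)
      (h _ (Subgroup.mem_map_of_mem _ hg))).symm
  · rintro h _ ⟨g, hg, rfl⟩
    ext1 z
    exact (h g hg z).symm

theorem conj_mem_equivariantAut {k : Type*} [Field k] {n : ℕ} {G : Subgroup (GL (Fin n) k)}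
    (P : GL (Fin n) k) {φ : Equiv.Perm (Fin n → k)} (hφ : φ ∈ equivariantAut G) :
    MulAut.conj (linearPerm k n P) φ ∈ equivariantAut (G.map (MulAut.conj P).toMonoidHom) := by
  refine Subgroup.mem_inf.2 ⟨?_, ?_⟩
  · exact mul_mem (mul_mem (linearPerm_mem_polyAut P) hφ.1) (inv_mem (linearPerm_mem_polyAut P))
  · have h := Subgroup.mem_centralizer_iff.1 hφ.2
    rw [Subgroup.mem_centralizer_iff]
    rintro _ ⟨_, ⟨g, hg, rfl⟩, rfl⟩
    have h1 := h _ (Subgroup.mem_map_of_mem (linearPerm k n) hg)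
    simp only [MulEquiv.toMonoidHom_eq_coe, MonoidHom.coe_coe, MulAut.conj_apply, map_mul, map_inv]
    simp only [mul_assoc, inv_mul_cancel_left]
    rw [← mul_assoc _ φ, h1, mul_assoc]

theorem equivariantAut_map_conj {k : Type*} [Field k] {n : ℕ} (G : Subgroup (GL (Fin n) k))
    (P : GL (Fin n) k) :
    (equivariantAut G).map (MulAut.conj (linearPerm k n P)).toMonoidHom =
      equivariantAut (G.map (MulAut.conj P).toMonoidHom) := by
  apply le_antisymm
  · rintro _ ⟨φ, hφ, rfl⟩
    exact conj_mem_equivariantAut P hφ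
  · intro φ hφ
    refine ⟨MulAut.conj (linearPerm k n P⁻¹) φ, ?_, ?_⟩
    · have h := conj_mem_equivariantAut P⁻¹ hφ
      rw [Subgroup.map_map] at h
      have : (MulAut.conj P⁻¹).toMonoidHom.comp (MulAut.conj P).toMonoidHom = MonoidHom.id _ := by
        ext1 x; simp [mul_assoc]
      rwa [this, Subgroup.map_id] at h
    · simp [mul_assoc]

/-! ### Homogeneous components and leading forms of polynomial maps. -/

namespace MvPolynomial

variable {k : Type*} [Field k] {n : ℕ}

theorem IsHomogeneous.eval_smul {h : MvPolynomial (Fin n) k} {d : ℕ} (hh : h.IsHomogeneous d)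
    (t : k) (z : Fin n → k) : eval (t • z) h = t ^ d * eval z h := by
  rw [eval_eq', eval_eq', Finset.mul_sum]
  refine Finset.sum_congr rfl fun s hs => ?_
  have h2 : ∑ i, s i = d := by
    rw [hh.degree_eq_sum_deg_support hs]
    exact (Finset.sum_subset (Finset.subset_univ _) (by simp)).symm
  simp only [Pi.smul_apply, smul_eq_mul, mul_pow, Finset.prod_mul_distrib, Finset.prod_pow_eq_pow_sum,
    h2]
  ring

/-- The restriction of a polynomial to the line through `0` and `z`. -/
noncomputable def alongRay (p : MvPolynomial (Fin n) k) (z : Fin n → k) : Polynomial k :=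
  aeval (fun i => Polynomial.C (z i) * Polynomial.X) p

theorem eval_alongRay (p : MvPolynomial (Fin n) k) (z : Fin n → k) (t : k) :
    (alongRay p z).eval t = eval (t • z) p := by
  induction p using MvPolynomial.induction_on with
  | C a => simp [alongRay]
  | add p q hp hq =>
    simp only [alongRay, map_add, Polynomial.eval_add] at *
    rw [hp, hq]
  | mul_X p i hp =>
    simp only [alongRay, map_mul, Polynomial.eval_mul, aeval_X, eval_X] at *
    rw [hp]; simp [mul_comm]

/-- Restriction to the ray turns the grading into powers of `t`, so identities between homogeneous
components follow from identities between polynomials in one variable. -/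
theorem coeff_alongRay [Infinite k] (p : MvPolynomial (Fin n) k) (z : Fin n → k) (d : ℕ) :
    (alongRay p z).coeff d = eval z (homogeneousComponent d p) := by
  have h : alongRay p z = ∑ i ∈ Finset.range (p.totalDegree + 1),
      Polynomial.C (eval z (homogeneousComponent i p)) * Polynomial.X ^ i := by
    refine Polynomial.funext fun t => ?_
    rw [eval_alongRay]
    conv_lhs => rw [← sum_homogeneousComponent p]
    rw [map_sum, Polynomial.eval_finsetSum]
    refine Finset.sum_congr rfl fun i _ => ?_
    rw [(homogeneousComponent_isHomogeneous i p).eval_smul, Polynomial.eval_mul, Polynomial.eval_C,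
      Polynomial.eval_pow, Polynomial.eval_X, mul_comm]
  rw [h]
  rw [Polynomial.finsetSum_coeff, Finset.sum_congr rfl fun i _ => Polynomial.coeff_C_mul_X_pow _ _ _,
    Finset.sum_ite_eq]
  split_ifs with h1
  · rfl
  · rw [Finset.mem_range] at h1
    rw [homogeneousComponent_eq_zero _ _ (by omega), map_zero]

/-- The homogeneous components of an equivariant polynomial map are equivariant. -/
theorem eval_homogeneousComponent_mulVec [Infinite k] (p : Fin n → MvPolynomial (Fin n) k)
    (M : Matrix (Fin n) (Fin n) k)
    (h : ∀ z i, eval (M.mulVec z) (p i) = M.mulVec (fun j => eval z (p j)) i) (d : ℕ)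
    (z : Fin n → k) (i : Fin n) :
    eval (M.mulVec z) (homogeneousComponent d (p i)) =
      M.mulVec (fun j => eval z (homogeneousComponent d (p j))) i := by
  -- Since `M (t z) = t (M z)`, equivariance along a ray is an identity of polynomials in `t`; its
  -- coefficient of `t ^ d` is the claim.
  have h1 : alongRay (p i) (M.mulVec z) = ∑ j, Polynomial.C (M i j) * alongRay (p j) z := by
    refine Polynomial.funext fun t => ?_
    rw [eval_alongRay, ← Matrix.mulVec_smul, h, Polynomial.eval_finsetSum]
    simp [Matrix.mulVec, dotProduct, eval_alongRay]
  have h2 := congrArg (fun q => Polynomial.coeff q d) h1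
  simpa [Polynomial.finsetSum_coeff, coeff_alongRay, Matrix.mulVec, dotProduct] using h2

/-- Degree `e * D` is reached only by the monomials of `q` of degree `e`, and there only through the
coefficients of degree `D` of the substituted polynomials. -/
theorem coeff_aeval_mul_of_natDegree_le (q : MvPolynomial (Fin 2) k) (a : Fin 2 → Polynomial k)
    {D e : ℕ} (hD : 0 < D) (ha : ∀ i, (a i).natDegree ≤ D) (hq : q.totalDegree ≤ e) :
    (aeval a q).coeff (e * D) = eval (fun i => (a i).coeff D) (homogeneousComponent e q) := by
  have hdeg : ∀ s : Fin 2 →₀ ℕ, s.degree = s 0 + s 1 := fun s => by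
    rw [Finsupp.degree_eq_sum, Fin.sum_univ_two]
  have key : ∀ s : Fin 2 →₀ ℕ, s.degree ≤ e → (a 0 ^ s 0 * a 1 ^ s 1).coeff (e * D) =
      if s.degree = e then (a 0).coeff D ^ s 0 * (a 1).coeff D ^ s 1 else 0 := by
    intro s hs
    have h0 : (a 0 ^ s 0).natDegree ≤ s 0 * D := Polynomial.natDegree_pow_le_of_le _ (ha 0)
    have h1 : (a 1 ^ s 1).natDegree ≤ s 1 * D := Polynomial.natDegree_pow_le_of_le _ (ha 1)
    split_ifs with h
    · rw [← h, hdeg, add_mul, Polynomial.coeff_mul_add_eq_of_natDegree_le h0 h1,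
        Polynomial.coeff_pow_of_natDegree_le (ha 0), Polynomial.coeff_pow_of_natDegree_le (ha 1)]
    · refine Polynomial.coeff_eq_zero_of_natDegree_lt ?_
      refine (Polynomial.natDegree_mul_le_of_le h0 h1).trans_lt ?_
      rw [← add_mul, ← hdeg]
      exact Nat.mul_lt_mul_of_pos_right (lt_of_le_of_ne hs h) hD
  have hmv : aeval a q = ∑ s ∈ q.support, Polynomial.C (q.coeff s) * (a 0 ^ s 0 * a 1 ^ s 1) := by
    rw [aeval_eq_eval₂Hom, coe_eval₂Hom, eval₂_eq']
    simp [Fin.prod_univ_two]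
  rw [hmv, Polynomial.finsetSum_coeff, homogeneousComponent_apply, map_sum, Finset.sum_filter]
  refine Finset.sum_congr rfl fun s hs => ?_
  have hse : s.degree ≤ e := by
    refine le_trans ?_ ((le_totalDegree hs).trans hq |>.trans_eq rfl)
    rw [hdeg, Finsupp.sum_fintype _ _ (by simp), Fin.sum_univ_two]
  rw [Polynomial.coeff_C_mul, key s hse]
  split_ifs with h
  · rw [eval_monomial, Finsupp.prod_fintype _ _ (by simp), Fin.prod_univ_two]
  · simp

theorem natDegree_alongRay_le [Infinite k] (p : MvPolynomial (Fin n) k) (z : Fin n → k) :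
    (alongRay p z).natDegree ≤ p.totalDegree := by
  refine Polynomial.natDegree_le_iff_coeff_eq_zero.2 fun N hN => ?_
  rw [coeff_alongRay, homogeneousComponent_eq_zero _ _ (by exact_mod_cast hN), map_zero]

/-- Comparison of coefficients for polynomials that are semi-invariant under rescaling the
coordinates. -/
theorem prod_pow_mul_coeff_of_eval_mul [Infinite k] {p q : MvPolynomial (Fin n) k} {c : Fin n → k}
    {a : k} (h : ∀ z, eval (fun i => c i * z i) p = a * eval z q) (s : Fin n →₀ ℕ) :
    (∏ i, c i ^ s i) * p.coeff s = a * q.coeff s := by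
  -- The left side is `p` with each variable multiplied by `c i`.
  have hp : (∑ s ∈ p.support, monomial s ((∏ i, c i ^ s i) * p.coeff s)) = C a * q := by
    refine MvPolynomial.funext fun z => ?_
    rw [map_mul, eval_C, ← h, map_sum, eval_eq']
    refine Finset.sum_congr rfl fun s _ => ?_
    rw [eval_monomial, Finsupp.prod_fintype _ _ (by simp)]
    simp only [mul_pow, Finset.prod_mul_distrib]
    ring
  have h2 := congrArg (coeff s) hp
  rw [coeff_C_mul, coeff_sum] at h2
  simp only [coeff_monomial, Finset.sum_ite_eq'] at h2
  rw [← h2]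
  split_ifs with hs
  · rfl
  · rw [notMem_support_iff.1 hs, mul_zero]

end MvPolynomial

namespace MvPolynomial

variable {k : Type*} [Field k] {n : ℕ}

/-- Polynomials in any number of variables that are related by a nonzero binary form are
proportional. -/
theorem proportional_of_binary_form [Infinite k] {T : MvPolynomial (Fin 2) k} {e : ℕ}
    (hT : T.IsHomogeneous e) (hT0 : T ≠ 0) (a : Fin 2 → MvPolynomial (Fin n) k)
    (h : ∀ z, eval (fun i => eval z (a i)) T = 0) :
    a 1 = 0 ∨ ∃ r : k, a 0 = C r * a 1 := by
  classical
  -- Dehomogenization of `T`: its roots are the only possible ratios of the two polynomials.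
  set τ : Polynomial k := aeval ![Polynomial.X, 1] T with hτ
  have hτe : ∀ x, τ.eval x = eval ![x, 1] T := by
    intro x
    rw [hτ, ← Polynomial.coe_evalRingHom, ← Polynomial.coe_aeval_eq_evalRingHom]
    change (Polynomial.aeval x) ((aeval ![Polynomial.X, 1]) T) = _
    rw [← AlgHom.comp_apply, comp_aeval]
    have : (fun i => (Polynomial.aeval x) ((![Polynomial.X, 1] : Fin 2 → Polynomial k) i)) =
        ![x, 1] := by
      funext i; fin_cases i <;> simp
    rw [this]; rfl
  have hom : ∀ x y : k, y ≠ 0 → eval ![x, y] T = y ^ e * τ.eval (x / y) := by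
    intro x y hy
    rw [hτe, ← hT.eval_smul]
    congr 2
    funext i
    fin_cases i <;> simp [mul_div_cancel₀ _ hy]
  have hτ0 : τ ≠ 0 := by
    intro h0
    have : T * X 1 = 0 := by
      refine MvPolynomial.funext fun z => ?_
      rw [map_mul, eval_X, map_zero, mul_eq_zero]
      by_cases hz : z 1 = 0
      · exact Or.inr hz
      · left
        have hz' : z = ![z 0, z 1] := by funext i; fin_cases i <;> rfl
        rw [hz', hom _ _ hz, h0]; simp
    exact (mul_ne_zero hT0 (X_ne_zero _)) this
  -- At each point either `a 1` vanishes or the ratio is a root of `τ` in `k`. The product thus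
  -- vanishes everywhere, hence as a polynomial, so one factor is zero; `T` need not split over `k`.
  have hprod : a 1 * ∏ r ∈ τ.roots.toFinset, (a 0 - C r * a 1) = 0 := by
    refine MvPolynomial.funext fun z => ?_
    rw [map_mul, map_prod, map_zero, mul_eq_zero]
    by_cases hz : eval z (a 1) = 0
    · exact Or.inl hz
    · right
      refine Finset.prod_eq_zero (i := eval z (a 0) / eval z (a 1)) ?_ ?_
      · rw [Multiset.mem_toFinset, Polynomial.mem_roots hτ0, Polynomial.IsRoot]
        have h1 := h z
        have hz' : (fun i => eval z (a i)) = ![eval z (a 0), eval z (a 1)] := by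
          funext i; fin_cases i <;> rfl
        rw [hz', hom _ _ hz] at h1
        exact (mul_eq_zero.1 h1).resolve_left (pow_ne_zero _ hz)
      · rw [map_sub, map_mul, eval_C, div_mul_cancel₀ _ hz, sub_self]
  rcases mul_eq_zero.1 hprod with h1 | h1
  · exact Or.inl h1
  · obtain ⟨r, -, hr⟩ := Finset.prod_eq_zero_iff.1 h1
    exact Or.inr ⟨r, sub_eq_zero.1 hr⟩

/-- The top-degree part of a nonlinear polynomial map of the plane with a polynomial left inverse
has proportional components. -/
theorem proportional_of_leftInverse [Infinite k] (p : Fin 2 → MvPolynomial (Fin 2) k)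
    (q : MvPolynomial (Fin 2) k) {D : ℕ} (hD : 2 ≤ D) (hp : ∀ i, (p i).totalDegree ≤ D)
    (hq : ∀ z, eval (fun i => eval z (p i)) q = z 0) :
    homogeneousComponent D (p 1) = 0 ∨
      ∃ r : k, homogeneousComponent D (p 0) = C r * homogeneousComponent D (p 1) := by
  have he : q.totalDegree ≠ 0 := by
    intro h0
    rw [totalDegree_eq_zero_iff_eq_C] at h0
    have h1 := hq 0
    have h2 := hq 1
    rw [h0, eval_C] at h1 h2
    rw [h1] at h2
    simp at h2
  set e := q.totalDegree
  have hT0 : homogeneousComponent e q ≠ 0 := by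
    intro h0
    have hne : q.support.Nonempty := by
      rw [Finset.nonempty_iff_ne_empty, Ne, support_eq_empty]
      rintro rfl
      exact he totalDegree_zero
    obtain ⟨s, hs, hse⟩ := Finset.exists_mem_eq_sup _ hne fun s : Fin 2 →₀ ℕ => s.sum fun _ e => e
    have h1 := congrArg (coeff s) h0
    have h2 : s.degree = e := hse.symm
    rw [coeff_homogeneousComponent, if_pos h2, coeff_zero] at h1
    exact mem_support_iff.1 hs h1
  refine proportional_of_binary_form (homogeneousComponent_isHomogeneous e q) hT0
    (fun i => homogeneousComponent D (p i)) fun z => ?_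
  have h1 := coeff_aeval_mul_of_natDegree_le q (fun i => alongRay (p i) z) (D := D) (e := e)
    (by omega) (fun i => (natDegree_alongRay_le _ _).trans (hp i)) le_rfl
  simp only [coeff_alongRay] at h1
  rw [← h1]
  have h2 : aeval (fun i => alongRay (p i) z) q = Polynomial.C (z 0) * Polynomial.X := by
    refine Polynomial.funext fun t => ?_
    have h3 := hq (t • z)
    simp only [← eval_alongRay] at h3
    rw [Polynomial.eval_mul, Polynomial.eval_C, Polynomial.eval_X, mul_comm, ← smul_eq_mul,
      ← Pi.smul_apply, ← h3]
    change (Polynomial.aeval t) _ = _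
    rw [← AlgHom.comp_apply, comp_aeval]
    rfl
  -- Along a ray `q ∘ p` is `z 0 * t`, which has no term of degree `e * D ≥ 2`.
  have h4 : 2 ≤ e * D := hD.trans (Nat.le_mul_of_pos_left _ (Nat.pos_of_ne_zero he))
  rw [h2, Polynomial.coeff_C_mul_X, if_neg (by omega)]

end MvPolynomial

/-! ### From a nonlinear automorphism to a semi-invariant form. -/

open MvPolynomial

theorem mem_range_linearPerm_of_forall_eq_mulVec {k : Type*} [Field k] {n : ℕ}
    {φ : Equiv.Perm (Fin n → k)} (M : Matrix (Fin n) (Fin n) k) (h : ∀ z, φ z = M.mulVec z) :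
    φ ∈ (linearPerm k n).range := by
  have hM : IsUnit M := by
    rw [← Matrix.mulVec_injective_iff_isUnit]
    intro x y hxy
    exact φ.injective (by rw [h, h]; exact hxy)
  obtain ⟨g, rfl⟩ := hM
  exact ⟨g, Equiv.ext fun z => (h z).symm⟩

/-- A polynomial automorphism all of whose homogeneous components of degree other than one vanish
is linear. -/
theorem mem_range_linearPerm_of_homogeneousComponent {k : Type*} [Field k] {n : ℕ}
    {φ : Equiv.Perm (Fin n → k)} (p : Fin n → MvPolynomial (Fin n) k)
    (hp : ∀ z i, φ z i = eval z (p i))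
    (h : ∀ d, d ≠ 1 → ∀ i, homogeneousComponent d (p i) = 0) : φ ∈ (linearPerm k n).range := by
  have hhom : ∀ i, (p i).IsHomogeneous 1 := by
    intro i s hs
    by_contra hne
    have h1 := congrArg (coeff s) (h s.degree (by rwa [Finsupp.degree_eq_weight_one]) i)
    rw [coeff_homogeneousComponent, if_pos rfl, coeff_zero] at h1
    exact hs h1
  have hspan : ∀ q : MvPolynomial (Fin n) k, q.IsHomogeneous 1 →
      ∃ c : Fin n → k, ∀ z, eval z q = ∑ j, c j * z j := by
    intro q hq
    rw [← mem_homogeneousSubmodule, homogeneousSubmodule_one_eq_span_X,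
      Submodule.mem_span_range_iff_exists_fun] at hq
    obtain ⟨c, rfl⟩ := hq
    exact ⟨c, fun z => by simp [smul_eval]⟩
  choose c hc using fun i => hspan (p i) (hhom i)
  refine mem_range_linearPerm_of_forall_eq_mulVec (Matrix.of c) fun z => funext fun i => ?_
  rw [hp, hc]; rfl

/-- A nonlinear equivariant automorphism of the plane yields a semi-invariant form whose degree is
not one and whose weight is that of a common eigenvector. -/
theorem exists_semiinvariant_form {k : Type*} [Field k] [Infinite k] {G : Subgroup (GL (Fin 2) k)}
    {φ : Equiv.Perm (Fin 2 → k)} (hφ : φ ∈ equivariantAut G) (hl : φ ∉ (linearPerm k 2).range) :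
    ∃ (d : ℕ) (w : Fin 2 → k) (h : MvPolynomial (Fin 2) k), d ≠ 1 ∧ w ≠ 0 ∧ h ≠ 0 ∧
      h.IsHomogeneous d ∧ ∀ g ∈ G, ∀ z,
        eval ((g : Matrix (Fin 2) (Fin 2) k).mulVec z) h • w =
          eval z h • (g : Matrix (Fin 2) (Fin 2) k).mulVec w := by
  obtain ⟨⟨⟨p, hp⟩, ⟨q, hq⟩⟩, hG⟩ := mem_equivariantAut_iff.1 hφ
  have hpz : ∀ z, (fun i => eval z (p i)) = φ z := fun z => funext fun i => (hp z i).symm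
  have hcomp : ∀ d, ∀ g ∈ G, ∀ z i,
      eval ((g : Matrix (Fin 2) (Fin 2) k).mulVec z) (homogeneousComponent d (p i)) =
        (g : Matrix (Fin 2) (Fin 2) k).mulVec
          (fun j => eval z (homogeneousComponent d (p j))) i := by
    intro d g hg z i
    refine eval_homogeneousComponent_mulVec p _ (fun z i => ?_) d z i
    rw [hpz, ← hG g hg, hp]
  have key : ∃ (d : ℕ) (w : Fin 2 → k) (h : MvPolynomial (Fin 2) k), d ≠ 1 ∧ w ≠ 0 ∧ h ≠ 0 ∧
      h.IsHomogeneous d ∧ ∀ i, homogeneousComponent d (p i) = C (w i) * h := by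
    obtain ⟨d₀, hd₀, i₀, hi₀⟩ : ∃ d, d ≠ 1 ∧ ∃ i, homogeneousComponent d (p i) ≠ 0 := by
      by_contra! hcon
      exact hl (mem_range_linearPerm_of_homogeneousComponent p hp hcon)
    obtain ⟨D, hD⟩ : ∃ D, D = max (p 0).totalDegree (p 1).totalDegree := ⟨_, rfl⟩
    have hpD : ∀ i, (p i).totalDegree ≤ D := by
      intro i; fin_cases i <;> simp [hD]
    have hd₀D : d₀ ≤ D := by
      by_contra! hlt
      exact hi₀ (homogeneousComponent_eq_zero _ _ ((hpD i₀).trans_lt hlt))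
    rcases Nat.eq_zero_or_pos d₀ with rfl | hpos
    -- With a nonzero constant term, the form is `1` and `w` is the image of the origin.
    · refine ⟨0, fun i => coeff 0 (p i), 1, zero_ne_one, ?_, one_ne_zero, isHomogeneous_one _ _,
        fun i => by rw [homogeneousComponent_zero, mul_one]⟩
      intro h0
      rw [homogeneousComponent_zero] at hi₀
      exact hi₀ (by rw [show coeff 0 (p i₀) = 0 from congrFun h0 i₀, C_0])
    · have hD2 : 2 ≤ D := by omega
      obtain ⟨i₁, hi₁⟩ : ∃ i, homogeneousComponent D (p i) ≠ 0 := by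
        obtain ⟨i, hi⟩ : ∃ i, (p i).totalDegree = D := by
          rcases max_choice (p 0).totalDegree (p 1).totalDegree with h | h
          · exact ⟨0, by rw [hD, h]⟩
          · exact ⟨1, by rw [hD, h]⟩
        refine ⟨i, fun h0 => ?_⟩
        have hne : (p i).support.Nonempty := by
          rw [Finset.nonempty_iff_ne_empty, Ne, support_eq_empty]
          intro h1
          rw [h1, totalDegree_zero] at hi
          omega
        obtain ⟨s, hs, hse⟩ :=
          Finset.exists_mem_eq_sup _ hne fun s : Fin 2 →₀ ℕ => s.sum fun _ e => e
        have h1 := congrArg (coeff s) h0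
        have h2 : s.degree = D := hse.symm.trans hi
        rw [coeff_homogeneousComponent, if_pos h2, coeff_zero] at h1
        exact mem_support_iff.1 hs h1
      have hq' : ∀ z, eval (fun i => eval z (p i)) (q 0) = z 0 := by
        intro z
        rw [hpz, ← hq, Equiv.symm_apply_apply]
      rcases proportional_of_leftInverse p (q 0) hD2 hpD hq' with h1 | ⟨r, hr⟩
      · refine ⟨D, ![1, 0], homogeneousComponent D (p 0), by omega, fun h => ?_, fun h => ?_,
          homogeneousComponent_isHomogeneous _ _, fun i => ?_⟩
        · simpa using congrFun h 0
        · fin_cases i₁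
          · exact hi₁ h
          · exact hi₁ h1
        · fin_cases i
          · simp
          · simpa using h1
      · refine ⟨D, ![r, 1], homogeneousComponent D (p 1), by omega, fun h => ?_, fun h => ?_,
          homogeneousComponent_isHomogeneous _ _, fun i => ?_⟩
        · simpa using congrFun h 1
        · fin_cases i₁
          · exact hi₁ (by simp [hr, h])
          · exact hi₁ h
        · fin_cases i
          · simpa using hr
          · simp
  obtain ⟨d, w, h, hd, hw, hh, hhom, hwh⟩ := key
  refine ⟨d, w, h, hd, hw, hh, hhom, fun g hg z => funext fun i => ?_⟩
  have h1 := hcomp d g hg z i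
  simp only [hwh, map_mul, eval_C] at h1
  rw [← Matrix.mulVec_smul, Pi.smul_apply, smul_eq_mul, mul_comm, h1]
  congr 1
  funext j
  simp [mul_comm]

/-! ### Reductive groups with a common eigenvector are diagonalizable. -/

section Triangular

variable {k : Type*} [Field k] {G : Subgroup (GL (Fin 2) k)} {w : Fin 2 → k}

theorem inv_mulVec_of_mulVec_eq_smul {n : ℕ} {g : GL (Fin n) k} {w : Fin n → k} {c : k}
    (hw : w ≠ 0) (h : (g : Matrix (Fin n) (Fin n) k).mulVec w = c • w) :
    c ≠ 0 ∧ ((g⁻¹ : GL (Fin n) k) : Matrix (Fin n) (Fin n) k).mulVec w = c⁻¹ • w := by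
  have h1 : ((g⁻¹ : GL (Fin n) k) : Matrix (Fin n) (Fin n) k).mulVec (c • w) = w := by
    rw [← h, Matrix.mulVec_mulVec, Units.inv_mul, Matrix.one_mulVec]
  have hc : c ≠ 0 := by
    rintro rfl
    rw [zero_smul, Matrix.mulVec_zero] at h1
    exact hw h1.symm
  refine ⟨hc, ?_⟩
  rw [Matrix.mulVec_smul] at h1
  rw [← h1, smul_smul, inv_mul_cancel₀ hc, one_smul, h1]

/-- An eigenvector of a `2 × 2` matrix gives a root of the characteristic polynomial. -/
theorem sq_sub_trace_mul_add_det_eq_zero {M : Matrix (Fin 2) (Fin 2) k} {c : k} (hw : w ≠ 0)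
    (h : M.mulVec w = c • w) : c ^ 2 - M.trace * c + M.det = 0 := by
  have h1 : (M - Matrix.scalar (Fin 2) c).det = 0 := by
    refine Matrix.exists_mulVec_eq_zero_iff.1 ⟨w, hw, ?_⟩
    rw [Matrix.sub_mulVec, h, sub_eq_zero]
    simp
  rw [Matrix.det_fin_two] at h1
  rw [Matrix.trace_fin_two, Matrix.det_fin_two, ← h1]
  simp
  ring

/-- The elements fixing `w` with determinant one form a closed unipotent subgroup, normal in `G`
because `G` preserves the line of `w`. Reductivity makes it trivial. -/
theorem IsReductive.eq_one_of_fix (hG : IsReductive G) (hw : w ≠ 0)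
    (heig : ∀ g ∈ G, ∃ c : k, (g : Matrix (Fin 2) (Fin 2) k).mulVec w = c • w)
    {g : GL (Fin 2) k} (hg : g ∈ G) (hgw : (g : Matrix (Fin 2) (Fin 2) k).mulVec w = w)
    (hdet : (g : Matrix (Fin 2) (Fin 2) k).det = 1) : g = 1 := by
  let U : Subgroup (GL (Fin 2) k) :=
    { carrier := {g | g ∈ G ∧ (g : Matrix (Fin 2) (Fin 2) k).mulVec w = w ∧
        (g : Matrix (Fin 2) (Fin 2) k).det = 1}
      one_mem' := ⟨G.one_mem, by simp, by simp⟩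
      mul_mem' := by
        rintro a b ⟨ha, ha1, ha2⟩ ⟨hb, hb1, hb2⟩
        refine ⟨G.mul_mem ha hb, ?_, ?_⟩
        · rw [Units.val_mul, ← Matrix.mulVec_mulVec, hb1, ha1]
        · rw [Units.val_mul, Matrix.det_mul, ha2, hb2, one_mul]
      inv_mem' := by
        rintro a ⟨ha, ha1, ha2⟩
        refine ⟨G.inv_mem ha, ?_, ?_⟩
        · have := (inv_mulVec_of_mulVec_eq_smul (g := a) (c := 1) hw (by rw [ha1, one_smul])).2
          rwa [inv_one, one_smul] at this
        · rw [Matrix.coe_units_inv, Matrix.det_nonsing_inv, ha2, Ring.inverse_one] }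
  have hU : U = ⊥ := by
    refine hG.unipotent U (fun g hg => hg.1) ?_ ?_ ?_
    · obtain ⟨I, hI⟩ := hG.closed
      refine ⟨I ∪ {X (0, 0) * C (w 0) + X (0, 1) * C (w 1) - C (w 0),
        X (1, 0) * C (w 0) + X (1, 1) * C (w 1) - C (w 1),
        X (0, 0) * X (1, 1) - X (0, 1) * X (1, 0) - 1}, fun g => ?_⟩
      change (g ∈ G ∧ _ ∧ _) ↔ _
      have h1 : (g : Matrix (Fin 2) (Fin 2) k).mulVec w = w ↔
          ((g : Matrix (Fin 2) (Fin 2) k) 0 0 * w 0 + (g : Matrix (Fin 2) (Fin 2) k) 0 1 * w 1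
            - w 0 = 0 ∧ (g : Matrix (Fin 2) (Fin 2) k) 1 0 * w 0 +
            (g : Matrix (Fin 2) (Fin 2) k) 1 1 * w 1 - w 1 = 0) := by
        rw [funext_iff, Fin.forall_fin_two]
        simp [Matrix.mulVec, dotProduct, Fin.sum_univ_two, sub_eq_zero]
      have h2 := hI g
      rw [SetLike.mem_coe] at h2
      rw [h1, h2, Matrix.det_fin_two, ← sub_eq_zero (b := (1 : k))]
      simp only [Set.mem_union, or_imp, forall_and, Set.mem_insert_iff, Set.mem_singleton_iff,
        forall_eq, map_sub, map_add, map_mul, eval_X, eval_C, map_one, and_assoc]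
    · rintro g hg u ⟨hu, hu1, hu2⟩
      refine ⟨G.mul_mem (G.mul_mem hg hu) (G.inv_mem hg), ?_, ?_⟩
      · obtain ⟨c, hc⟩ := heig g hg
        obtain ⟨hc0, hc'⟩ := inv_mulVec_of_mulVec_eq_smul hw hc
        rw [Units.val_mul, Units.val_mul, ← Matrix.mulVec_mulVec, ← Matrix.mulVec_mulVec, hc',
          Matrix.mulVec_smul, Matrix.mulVec_smul, hu1, hc, smul_smul, inv_mul_cancel₀ hc0, one_smul]
      · rw [Units.val_mul, Matrix.det_mul, Units.val_mul, Matrix.det_mul, hu2, mul_one,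
          ← Matrix.det_mul, ← Units.val_mul, mul_inv_cancel, Units.val_one, Matrix.det_one]
    · rintro u ⟨-, hu1, hu2⟩
      -- Eigenvalue one and determinant one force trace two, so `(u - 1) ^ 2 = 0`.
      have htr := sq_sub_trace_mul_add_det_eq_zero (c := 1) hw (by rw [hu1, one_smul])
      refine ⟨2, ?_⟩
      rw [hu2, Matrix.trace_fin_two] at htr
      rw [Matrix.det_fin_two] at hu2
      ext i j
      rw [pow_two]
      fin_cases i <;> fin_cases j <;> simp [Matrix.mul_apply, Fin.sum_univ_two] <;> grind
  have : g ∈ U := ⟨hg, hgw, hdet⟩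
  rwa [hU, Subgroup.mem_bot] at this

/-- Commutators fix `w` and have determinant one. -/
theorem IsReductive.mul_comm_of_eigenvector (hG : IsReductive G) (hw : w ≠ 0)
    (heig : ∀ g ∈ G, ∃ c : k, (g : Matrix (Fin 2) (Fin 2) k).mulVec w = c • w)
    {g h : GL (Fin 2) k} (hg : g ∈ G) (hh : h ∈ G) : g * h = h * g := by
  rw [← mul_inv_eq_one]
  refine hG.eq_one_of_fix hw heig (G.mul_mem (G.mul_mem hg hh) (G.inv_mem (G.mul_mem hh hg))) ?_ ?_
  · obtain ⟨c, hc⟩ := heig g hg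
    obtain ⟨b, hb⟩ := heig h hh
    obtain ⟨hc0, hc'⟩ := inv_mulVec_of_mulVec_eq_smul hw hc
    obtain ⟨hb0, hb'⟩ := inv_mulVec_of_mulVec_eq_smul hw hb
    rw [mul_inv_rev]
    simp only [Units.val_mul, ← Matrix.mulVec_mulVec, hc, hb, hc', hb', Matrix.mulVec_smul,
      smul_smul]
    rw [show b⁻¹ * c⁻¹ * (b * c) = 1 by field_simp, one_smul]
  · have : Matrix.GeneralLinearGroup.det (g * h * (h * g)⁻¹) = 1 := by
      rw [map_mul, map_inv, map_mul, map_mul, mul_comm (Matrix.GeneralLinearGroup.det g),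
        mul_inv_cancel]
    exact congrArg Units.val this

/-- If a form is semi-invariant under a matrix `c (1 + N)` with `N ^ 2 = 0`, with weight `c`, then
`c ^ d = c`. -/
theorem pow_eq_of_semiinvariant [Infinite k] {h : MvPolynomial (Fin 2) k} {d : ℕ}
    (hh : h.IsHomogeneous d) (h0 : h ≠ 0) {N : Matrix (Fin 2) (Fin 2) k} (hN : N * N = 0) {c : k}
    (hinv : ∀ z, eval (c • (z + N.mulVec z)) h = c * eval z h) : c ^ d = c := by
  obtain ⟨z, hz⟩ : ∃ z, eval z h ≠ 0 := by
    by_contra! hcon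
    exact h0 (MvPolynomial.funext fun z => by rw [hcon, map_zero])
  -- The restriction of `h` to the line `z + t N z`. As `N² = 0`, the matrix `c (1 + N)` moves the
  -- parameter `t` to `t + 1`, up to the scalar `c`; leading coefficients then compare `c ^ d` with
  -- `c`.
  set P : Polynomial k :=
    aeval (fun i => Polynomial.C (z i) + Polynomial.C (N.mulVec z i) * Polynomial.X) h
  have hP : ∀ t, P.eval t = eval (z + t • N.mulVec z) h := by
    intro t
    change (Polynomial.aeval t) _ = _
    rw [← AlgHom.comp_apply, comp_aeval]
    have : (fun i => (Polynomial.aeval t) (Polynomial.C (z i) +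
        Polynomial.C (N.mulVec z i) * Polynomial.X)) = z + t • N.mulVec z := by
      funext i
      change Polynomial.eval t (_ + _ * _) = z i + t * N.mulVec z i
      rw [Polynomial.eval_add, Polynomial.eval_mul, Polynomial.eval_C, Polynomial.eval_C,
        Polynomial.eval_X, mul_comm]
    rw [this]; rfl
  have hP0 : P ≠ 0 := by
    intro hP0
    have := hP 0
    rw [hP0, zero_smul, add_zero, Polynomial.eval_zero] at this
    exact hz this.symm
  have hfun : Polynomial.C (c ^ d) * P.comp (Polynomial.X + Polynomial.C 1) = Polynomial.C c * P := by
    refine Polynomial.funext fun t => ?_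
    have h1 := hinv (z + t • N.mulVec z)
    rw [hh.eval_smul] at h1
    simp only [Polynomial.eval_mul, Polynomial.eval_C, Polynomial.eval_comp, Polynomial.eval_add,
      Polynomial.eval_X, hP]
    rw [← h1, Matrix.mulVec_add, Matrix.mulVec_smul, Matrix.mulVec_mulVec, hN, Matrix.zero_mulVec,
      smul_zero, add_zero, add_smul, one_smul]
    congr 3
    abel
  have hlc := congrArg Polynomial.leadingCoeff hfun
  rw [Polynomial.leadingCoeff_mul, Polynomial.leadingCoeff_mul, Polynomial.leadingCoeff_comp
      (by rw [Polynomial.natDegree_X_add_C]; exact one_ne_zero),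
    Polynomial.leadingCoeff_C, Polynomial.leadingCoeff_C, Polynomial.leadingCoeff_X_add_C, one_pow,
    mul_one] at hlc
  exact mul_right_cancel₀ (Polynomial.leadingCoeff_ne_zero.2 hP0) hlc

theorem pow_eq_of_sq_eq_zero {N g : Matrix (Fin 2) (Fin 2) k} (hN : N * N = 0) {c : k}
    (hg : g = c • (1 + N)) (m : ℕ) : g ^ m = c ^ m • (1 + m • N) := by
  induction m with
  | zero => simp
  | succ m ih =>
    rw [pow_succ, ih, hg, smul_mul_smul_comm, ← pow_succ]
    congr 1
    rw [add_mul, one_mul, smul_mul_assoc, mul_add, mul_one, hN, add_zero, succ_nsmul]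
    abel

/-- A reductive group with a semi-invariant form of degree other than one, whose weight is that of
a common eigenvector, consists of scalars as soon as none of its elements has two different
eigenvalues. -/
theorem IsReductive.eq_scalar [CharZero k] (hG : IsReductive G) (hw : w ≠ 0)
    (heig : ∀ g ∈ G, ∃ c : k, (g : Matrix (Fin 2) (Fin 2) k).mulVec w = c • w)
    {h : MvPolynomial (Fin 2) k} {d : ℕ} (hd : d ≠ 1) (hh : h.IsHomogeneous d) (h0 : h ≠ 0)
    (hinv : ∀ g ∈ G, ∀ z, eval ((g : Matrix (Fin 2) (Fin 2) k).mulVec z) h • w =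
      eval z h • (g : Matrix (Fin 2) (Fin 2) k).mulVec w)
    {g : GL (Fin 2) k} (hg : g ∈ G) {c : k}
    (hgw : (g : Matrix (Fin 2) (Fin 2) k).mulVec w = c • w)
    (hdet : (g : Matrix (Fin 2) (Fin 2) k).det = c ^ 2) :
    (g : Matrix (Fin 2) (Fin 2) k) = c • 1 := by
  have hc := (inv_mulVec_of_mulVec_eq_smul hw hgw).1
  have htr := sq_sub_trace_mul_add_det_eq_zero hw hgw
  obtain ⟨N, hgN⟩ : ∃ N, (g : Matrix (Fin 2) (Fin 2) k) = c • (1 + N) :=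
    ⟨c⁻¹ • (g : Matrix (Fin 2) (Fin 2) k) - 1, by simp [smul_smul, hc]⟩
  -- Determinant `c ^ 2` makes `c` a double eigenvalue, so `N` has trace and determinant zero.
  have hN : N * N = 0 := by
    have htr' : N.trace = 0 := by
      rw [hdet, hgN, Matrix.trace_smul, Matrix.trace_add, Matrix.trace_one] at htr
      have : c ^ 2 * N.trace = 0 := by
        simp at htr
        linear_combination -htr
      exact (mul_eq_zero.1 this).resolve_left (pow_ne_zero _ hc)
    have hdet' : N.det = 0 := by
      rw [hgN, Matrix.det_smul, Fintype.card_fin] at hdet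
      have h1 : (1 + N).det = 1 := mul_left_cancel₀ (pow_ne_zero 2 hc) (by rw [hdet, mul_one])
      rw [Matrix.det_fin_two] at h1 ⊢
      rw [Matrix.trace_fin_two] at htr'
      simp at h1
      linear_combination h1 - htr'
    rw [Matrix.trace_fin_two] at htr'
    rw [Matrix.det_fin_two] at hdet'
    ext i j
    fin_cases i <;> fin_cases j <;> simp [Matrix.mul_apply, Fin.sum_univ_two] <;> grind
  have hcd : c ^ d = c := by
    refine pow_eq_of_semiinvariant hh h0 hN fun z => ?_
    have h1 := hinv g hg z
    rw [hgw, smul_smul, hgN, Matrix.smul_mulVec, Matrix.add_mulVec, Matrix.one_mulVec] at h1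
    rw [smul_left_injective k hw h1, mul_comm]
  -- Here `d ≠ 1` enters: `c ^ d = c` gives `c = 1` for `d = 0`, and `c ^ (d - 1) = 1` with positive
  -- exponent for `d ≥ 2`.
  obtain ⟨m, hm, hcm⟩ : ∃ m, 0 < m ∧ c ^ m = 1 := by
    rcases d with _ | d
    · exact ⟨1, one_pos, by rw [pow_one, ← hcd, pow_zero]⟩
    · exact ⟨d, by omega, mul_right_cancel₀ hc (by rw [one_mul, ← pow_succ, hcd])⟩
  have hgm := pow_eq_of_sq_eq_zero hN hgN m
  have hgm1 : g ^ m = 1 := by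
    refine hG.eq_one_of_fix hw heig (G.pow_mem hg m) ?_ ?_
    · rw [Units.val_pow_eq_pow_val, hgm, hcm, one_smul, Matrix.add_mulVec, Matrix.one_mulVec]
      have : N.mulVec w = 0 := by
        rw [hgN, Matrix.smul_mulVec, Matrix.add_mulVec, Matrix.one_mulVec] at hgw
        exact add_eq_left.1 (smul_right_injective _ hc hgw)
      rw [Matrix.smul_mulVec, this, smul_zero, add_zero]
    · rw [Units.val_pow_eq_pow_val, Matrix.det_pow, hdet, ← pow_mul, mul_comm, pow_mul, hcm, one_pow]
  -- `g ^ m = 1 + m N` is the identity, and `m` is invertible in characteristic zero.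
  have hN0 : N = 0 := by
    have h1 := congrArg Units.val hgm1
    rw [Units.val_pow_eq_pow_val, hgm, hcm, one_smul, Units.val_one] at h1
    have h2 : (m : k) • N = 0 := by
      rw [Nat.cast_smul_eq_nsmul]
      exact add_eq_left.1 h1
    exact (smul_eq_zero.1 h2).resolve_left (Nat.cast_ne_zero.2 hm.ne')
  rw [hgN, hN0, add_zero]

theorem exists_smul_add_smul {w w' : Fin 2 → k} (hww' : w 0 * w' 1 - w 1 * w' 0 ≠ 0)
    (v : Fin 2 → k) : ∃ a b : k, v = a • w + b • w' := by
  obtain ⟨D, hD⟩ : ∃ D, D = w 0 * w' 1 - w 1 * w' 0 := ⟨_, rfl⟩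
  rw [← hD] at hww'
  refine ⟨(v 0 * w' 1 - v 1 * w' 0) / D, (w 0 * v 1 - w 1 * v 0) / D, funext fun i => ?_⟩
  fin_cases i <;> simp <;> field_simp <;> rw [hD] <;> ring

theorem det_ne_zero_of_mulVec_eq_smul {M : Matrix (Fin 2) (Fin 2) k} {w w' : Fin 2 → k} {c c' : k}
    (hw : w ≠ 0) (hw' : w' ≠ 0) (hc : c ≠ c') (h : M.mulVec w = c • w)
    (h' : M.mulVec w' = c' • w') : w 0 * w' 1 - w 1 * w' 0 ≠ 0 := by
  intro h0
  obtain ⟨a, b, hab, hne⟩ : ∃ a b : k, a • w + b • w' = 0 ∧ (a ≠ 0 ∨ b ≠ 0) := by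
    by_cases h1 : w' 0 = 0
    · have h2 : w' 1 ≠ 0 := fun h2 => hw' (funext fun i => by fin_cases i <;> assumption)
      refine ⟨w' 1, - w 1, funext fun i => ?_, Or.inl h2⟩
      fin_cases i <;> simp <;> grind
    · refine ⟨w' 0, - w 0, funext fun i => ?_, Or.inl h1⟩
      fin_cases i <;> simp <;> grind
  have h1 := congrArg M.mulVec hab
  rw [Matrix.mulVec_add, Matrix.mulVec_smul, Matrix.mulVec_smul, h, h', Matrix.mulVec_zero] at h1
  have h2 : (a * (c - c')) • w = 0 := by
    have : (a * (c - c')) • w = (a • c • w + b • c' • w') - c' • (a • w + b • w') := by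
      module
    rw [this, h1, hab]; simp
  have h3 : (b * (c' - c)) • w' = 0 := by
    have : (b * (c' - c)) • w' = (a • c • w + b • c' • w') - c • (a • w + b • w') := by
      module
    rw [this, h1, hab]; simp
  rcases hne with h4 | h4
  · exact (smul_ne_zero (mul_ne_zero h4 (sub_ne_zero.2 hc)) hw) h2
  · exact (smul_ne_zero (mul_ne_zero h4 (sub_ne_zero.2 hc.symm)) hw') h3

/-- A reductive subgroup of `GL₂` with a nonlinear equivariant automorphism is diagonalizable. -/
theorem IsReductive.exists_eigenbasis [CharZero k] (hG : IsReductive G)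
    {φ : Equiv.Perm (Fin 2 → k)} (hφ : φ ∈ equivariantAut G) (hl : φ ∉ (linearPerm k 2).range) :
    ∃ w w' : Fin 2 → k, w 0 * w' 1 - w 1 * w' 0 ≠ 0 ∧ ∀ g ∈ G,
      (∃ c : k, (g : Matrix (Fin 2) (Fin 2) k).mulVec w = c • w) ∧
      ∃ c : k, (g : Matrix (Fin 2) (Fin 2) k).mulVec w' = c • w' := by
  obtain ⟨d, w, h, hd, hw, h0, hh, hinv⟩ := exists_semiinvariant_form hφ hl
  have heig : ∀ g ∈ G, ∃ c : k, (g : Matrix (Fin 2) (Fin 2) k).mulVec w = c • w := by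
    intro g hg
    obtain ⟨z, hz⟩ : ∃ z, eval z h ≠ 0 := by
      by_contra! hcon
      exact h0 (MvPolynomial.funext fun z => by rw [hcon, map_zero])
    refine ⟨(eval z h)⁻¹ * eval ((g : Matrix (Fin 2) (Fin 2) k).mulVec z) h, ?_⟩
    rw [mul_smul, hinv g hg, smul_smul, inv_mul_cancel₀ hz, one_smul]
  by_cases hdist : ∃ g ∈ G, ∃ c : k, (g : Matrix (Fin 2) (Fin 2) k).mulVec w = c • w ∧
      (g : Matrix (Fin 2) (Fin 2) k).det ≠ c ^ 2
  · obtain ⟨g, hg, c, hgw, hdet⟩ := hdist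
    have hc := (inv_mulVec_of_mulVec_eq_smul hw hgw).1
    -- The second eigenvalue is `det g / c`, so it lies in `k`.
    obtain ⟨c', hc'⟩ : ∃ c', (g : Matrix (Fin 2) (Fin 2) k).det = c * c' :=
      ⟨c⁻¹ * (g : Matrix (Fin 2) (Fin 2) k).det, by rw [mul_inv_cancel_left₀ hc]⟩
    have hcc' : c ≠ c' := by
      rintro rfl
      exact hdet (by rw [hc', sq])
    have htr := sq_sub_trace_mul_add_det_eq_zero hw hgw
    obtain ⟨w', hw', hgw'⟩ : ∃ w' ≠ 0, (g : Matrix (Fin 2) (Fin 2) k).mulVec w' = c' • w' := by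
      have h1 : ((g : Matrix (Fin 2) (Fin 2) k) - Matrix.scalar (Fin 2) c').det = 0 := by
        rw [hc'] at htr
        have htr' : c - (g : Matrix (Fin 2) (Fin 2) k).trace + c' = 0 :=
          (mul_eq_zero.1 (by linear_combination htr :
            c * (c - (g : Matrix (Fin 2) (Fin 2) k).trace + c') = 0)).resolve_left hc
        rw [Matrix.det_fin_two] at hc' ⊢
        rw [Matrix.trace_fin_two] at htr'
        simp
        linear_combination hc' + c' * htr'
      obtain ⟨w', hw', h2⟩ := Matrix.exists_mulVec_eq_zero_iff.2 h1
      refine ⟨w', hw', ?_⟩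
      rw [Matrix.sub_mulVec, sub_eq_zero] at h2
      rw [h2]
      simp
    have hww' := det_ne_zero_of_mulVec_eq_smul hw hw' hcc' hgw hgw'
    refine ⟨w, w', hww', fun f hf => ⟨heig f hf, ?_⟩⟩
    obtain ⟨a, b, hab⟩ := exists_smul_add_smul hww' ((f : Matrix (Fin 2) (Fin 2) k).mulVec w')
    -- Every `f` in `G` commutes with `g`, so it preserves the `c'`-eigenspace of `g`, which is the
    -- line of `w'`.
    have hcomm := hG.mul_comm_of_eigenvector hw heig hg hf
    have h1 : (g : Matrix (Fin 2) (Fin 2) k).mulVec ((f : Matrix (Fin 2) (Fin 2) k).mulVec w') =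
        c' • (f : Matrix (Fin 2) (Fin 2) k).mulVec w' := by
      rw [Matrix.mulVec_mulVec, ← Units.val_mul, hcomm, Units.val_mul, ← Matrix.mulVec_mulVec, hgw',
        Matrix.mulVec_smul]
    rw [hab, Matrix.mulVec_add, Matrix.mulVec_smul, Matrix.mulVec_smul, hgw, hgw'] at h1
    have h2 : (a * (c - c')) • w = 0 := by
      have : (a * (c - c')) • w = (a • c • w + b • c' • w') - c' • (a • w + b • w') := by
        module
      rw [this, h1, sub_self]
    have ha : a = 0 := by
      rcases smul_eq_zero.1 h2 with h3 | h3
      · exact (mul_eq_zero.1 h3).resolve_right (sub_ne_zero.2 hcc')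
      · exact absurd h3 hw
    exact ⟨b, by rw [hab, ha, zero_smul, zero_add]⟩
  -- All elements are scalar here, so any vector independent of `w` will do.
  · push Not at hdist
    obtain ⟨w', hww'⟩ : ∃ w' : Fin 2 → k, w 0 * w' 1 - w 1 * w' 0 ≠ 0 := by
      by_contra! hcon
      refine hw (funext fun i => ?_)
      fin_cases i
      · simpa using hcon ![0, 1]
      · simpa using hcon ![1, 0]
    refine ⟨w, w', hww', fun g hg => ⟨heig g hg, ?_⟩⟩
    obtain ⟨c, hc⟩ := heig g hg
    refine ⟨c, ?_⟩
    rw [hG.eq_scalar hw heig hd hh h0 hinv hg hc (hdist g hg c hc), Matrix.smul_mulVec,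
      Matrix.one_mulVec]

/-- Diagonalization by conjugation from a basis of common eigenvectors. -/
theorem exists_conj_diagonal {w w' : Fin 2 → k} (hww' : w 0 * w' 1 - w 1 * w' 0 ≠ 0)
    (h : ∀ g ∈ G, (∃ c : k, (g : Matrix (Fin 2) (Fin 2) k).mulVec w = c • w) ∧
      ∃ c : k, (g : Matrix (Fin 2) (Fin 2) k).mulVec w' = c • w') :
    ∃ P : GL (Fin 2) k, ∀ g ∈ G.map (MulAut.conj P).toMonoidHom,
      (g : Matrix (Fin 2) (Fin 2) k) 0 1 = 0 ∧ (g : Matrix (Fin 2) (Fin 2) k) 1 0 = 0 := by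
  let Q : GL (Fin 2) k := Matrix.GeneralLinearGroup.mkOfDetNeZero !![w 0, w' 0; w 1, w' 1]
    (by rw [Matrix.det_fin_two_of]; intro h0; exact hww' (by linear_combination h0))
  have hQ : (Q : Matrix (Fin 2) (Fin 2) k) = !![w 0, w' 0; w 1, w' 1] := rfl
  refine ⟨Q⁻¹, ?_⟩
  rintro _ ⟨g, hg, rfl⟩
  obtain ⟨⟨c, hc⟩, ⟨c', hc'⟩⟩ := h g hg
  have h1 : (g : Matrix (Fin 2) (Fin 2) k) * Q = Q * !![c, 0; 0, c'] := by
    rw [hQ]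
    have hc0 := congrFun hc 0
    have hc1 := congrFun hc 1
    have hc0' := congrFun hc' 0
    have hc1' := congrFun hc' 1
    simp [Matrix.mulVec, dotProduct, Fin.sum_univ_two] at hc0 hc1 hc0' hc1'
    ext i j
    fin_cases i <;> fin_cases j <;> simp [Matrix.mul_apply, Fin.sum_univ_two] <;> grind
  have h2 : ((MulAut.conj Q⁻¹ g : GL (Fin 2) k) : Matrix (Fin 2) (Fin 2) k) = !![c, 0; 0, c'] := by
    rw [MulAut.conj_apply, inv_inv, Units.val_mul, Units.val_mul, mul_assoc, h1, ← mul_assoc,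
      ← Units.val_mul, inv_mul_cancel, Units.val_one, one_mul]
  change ((MulAut.conj Q⁻¹ g : GL (Fin 2) k) : Matrix (Fin 2) (Fin 2) k) 0 1 = 0 ∧
    ((MulAut.conj Q⁻¹ g : GL (Fin 2) k) : Matrix (Fin 2) (Fin 2) k) 1 0 = 0
  rw [h2]
  simp

end Triangular

/-! ### Diagonal groups and weighted tori. -/

section Diagonal

variable {k : Type*} [Field k] {G : Subgroup (GL (Fin 2) k)}

theorem mulVec_of_offDiagonal_eq_zero {M : Matrix (Fin 2) (Fin 2) k} (h : M 0 1 = 0 ∧ M 1 0 = 0)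
    (z : Fin 2 → k) : M.mulVec z = fun i => M i i * z i := by
  funext i
  fin_cases i <;> simp [Matrix.mulVec, dotProduct, Fin.sum_univ_two, h]

/-- A component of an equivariant map for a diagonal group is divisible by the corresponding
variable unless one diagonal character is a power of the other. -/
theorem exists_pow_or_X_dvd [Infinite k]
    (hG : ∀ g ∈ G, (g : Matrix (Fin 2) (Fin 2) k) 0 1 = 0 ∧ (g : Matrix (Fin 2) (Fin 2) k) 1 0 = 0)
    {i j : Fin 2} (hij : i ≠ j) (p : MvPolynomial (Fin 2) k)
    (hp : ∀ g ∈ G, ∀ z, eval ((g : Matrix (Fin 2) (Fin 2) k).mulVec z) p =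
      (g : Matrix (Fin 2) (Fin 2) k) i i * eval z p) :
    (∃ v : ℕ, ∀ g ∈ G, (g : Matrix (Fin 2) (Fin 2) k) i i =
      (g : Matrix (Fin 2) (Fin 2) k) j j ^ v) ∨ X i ∣ p := by
  -- A monomial free of `X i` is a power of `X j`; comparing its coefficients makes the `i`th
  -- character that power of the `j`th.
  by_cases h : ∃ s ∈ p.support, s i = 0
  · obtain ⟨s, hs, hsi⟩ := h
    refine Or.inl ⟨s j, fun g hg => ?_⟩
    have h1 := prod_pow_mul_coeff_of_eval_mul (p := p) (q := p)
      (fun z => by rw [← mulVec_of_offDiagonal_eq_zero (hG g hg), hp g hg]) s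
    have h2 := mul_right_cancel₀ (mem_support_iff.1 hs) h1
    rw [← h2, Fin.prod_univ_two]
    fin_cases i <;> fin_cases j <;> simp_all
  · right
    push Not at h
    rw [← Ideal.mem_span_singleton, ← Set.image_singleton, mem_ideal_span_X_image]
    exact fun m hm => ⟨i, rfl, h m hm⟩

/-- If no such relation between the characters holds, `X i` divides the `i`th components of both `φ`
and its inverse. The two cofactors then multiply to one after substitution, so they are constants.
-/
theorem exists_pow_or_apply_eq_mul [Infinite k]
    (hG : ∀ g ∈ G, (g : Matrix (Fin 2) (Fin 2) k) 0 1 = 0 ∧ (g : Matrix (Fin 2) (Fin 2) k) 1 0 = 0)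
    {i j : Fin 2} (hij : i ≠ j) {φ : Equiv.Perm (Fin 2 → k)} (hφ : φ ∈ equivariantAut G) :
    (∃ v : ℕ, ∀ g ∈ G, (g : Matrix (Fin 2) (Fin 2) k) i i =
      (g : Matrix (Fin 2) (Fin 2) k) j j ^ v) ∨ ∃ c : k, ∀ z, φ z i = c * z i := by
  have hφ' := inv_mem hφ
  obtain ⟨⟨⟨p, hp⟩, -⟩, hpG⟩ := mem_equivariantAut_iff.1 hφ
  obtain ⟨⟨⟨q, hq⟩, -⟩, hqG⟩ := mem_equivariantAut_iff.1 hφ'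
  rcases exists_pow_or_X_dvd hG hij (p i) (fun g hg z => by
    rw [← hp, hpG g hg, mulVec_of_offDiagonal_eq_zero (hG g hg), ← hp]) with h1 | ⟨A, hA⟩
  · exact Or.inl h1
  rcases exists_pow_or_X_dvd hG hij (q i) (fun g hg z => by
    rw [← hq, hqG g hg, mulVec_of_offDiagonal_eq_zero (hG g hg), ← hq]) with h1 | ⟨B, hB⟩
  · exact Or.inl h1
  right
  have hunit : A * bind₁ p B = 1 := by
    have h1 : X i * (A * bind₁ p B) = X i * 1 := by
      refine MvPolynomial.funext fun z => ?_
      have h2 : φ⁻¹ (φ z) i = z i := congrFun (φ.symm_apply_apply z) i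
      have h3 : eval z (bind₁ p B) = eval (φ z) B := by
        have : φ z = fun j => eval z (p j) := funext (hp z)
        rw [this]
        change (eval₂Hom (RingHom.id k) z) (bind₁ p B) = _
        rw [eval₂Hom_bind₁]
        rfl
      rw [hq, hB, map_mul, eval_X, hp, hA, map_mul, eval_X, ← h3] at h2
      rw [map_mul, map_mul, map_mul, eval_X, map_one, mul_one, ← mul_assoc, h2]
    exact mul_left_cancel₀ (X_ne_zero i) h1
  obtain ⟨c, -, hc⟩ := isUnit_iff_eq_C_of_isReduced.1 (IsUnit.of_mul_eq_one _ hunit)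
  exact ⟨c, fun z => by rw [hp, hA, hc, map_mul, eval_X, eval_C, mul_comm]⟩

/-- The torus of the diagonal matrices with entries `l ^ v` and `l`. -/
def weightedTorus (k : Type*) [Field k] (v : ℕ) : kˣ →* GL (Fin 2) k :=
  Units.map
    { toFun := fun l => !![l ^ v, 0; 0, l]
      map_one' := by rw [one_pow, Matrix.one_fin_two]
      map_mul' := fun a b => by simp [mul_pow] }

theorem coe_weightedTorus (v : ℕ) (l : kˣ) :
    (weightedTorus k v l : Matrix (Fin 2) (Fin 2) k) = !![(l : k) ^ v, 0; 0, (l : k)] := rfl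

theorem mem_range_weightedTorus {v : ℕ} {g : GL (Fin 2) k} :
    g ∈ (weightedTorus k v).range ↔
      ∃ l : kˣ, (g : Matrix (Fin 2) (Fin 2) k) = !![(l : k) ^ v, 0; 0, (l : k)] := by
  constructor
  · rintro ⟨l, rfl⟩
    exact ⟨l, rfl⟩
  · rintro ⟨l, hl⟩
    exact ⟨l, Units.ext hl.symm⟩

theorem weightedTorus_injective (v : ℕ) : Function.Injective (weightedTorus k v) := by
  intro a b hab
  have := congrArg (fun g : GL (Fin 2) k => (g : Matrix (Fin 2) (Fin 2) k) 1 1) hab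
  simpa [coe_weightedTorus, Units.val_inj] using this

theorem coe_weightedTorus_mulVec (v : ℕ) (l : kˣ) (z : Fin 2 → k) :
    (weightedTorus k v l : Matrix (Fin 2) (Fin 2) k).mulVec z = ![(l : k) ^ v * z 0, l * z 1] := by
  rw [coe_weightedTorus]
  funext i
  fin_cases i <;> simp [Matrix.mulVec, dotProduct, Fin.sum_univ_two]

/-- A nonlinear equivariant automorphism forces a reductive group into a weighted torus. -/
theorem IsReductive.exists_map_conj_le [CharZero k] (hG : IsReductive G)
    {φ : Equiv.Perm (Fin 2 → k)} (hφ : φ ∈ equivariantAut G) (hl : φ ∉ (linearPerm k 2).range) :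
    ∃ (P : GL (Fin 2) k) (v : ℕ),
      G.map (MulAut.conj P).toMonoidHom ≤ (weightedTorus k v).range := by
  obtain ⟨w, w', hww', hdiag⟩ := hG.exists_eigenbasis hφ hl
  obtain ⟨P, hP⟩ := exists_conj_diagonal hww' hdiag
  have hφP := conj_mem_equivariantAut P hφ
  have hmem : ∀ (g : GL (Fin 2) k) (v : ℕ), (g : Matrix (Fin 2) (Fin 2) k) 0 1 = 0 →
      (g : Matrix (Fin 2) (Fin 2) k) 1 0 = 0 →
      (g : Matrix (Fin 2) (Fin 2) k) 0 0 = (g : Matrix (Fin 2) (Fin 2) k) 1 1 ^ v →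
      g ∈ (weightedTorus k v).range := by
    intro g v h1 h2 h3
    have hdet : (g : Matrix (Fin 2) (Fin 2) k).det ≠ 0 :=
      ((Matrix.isUnit_iff_isUnit_det _).1 g.isUnit).ne_zero
    rw [Matrix.det_fin_two, h1, zero_mul, sub_zero] at hdet
    refine mem_range_weightedTorus.2 ⟨Units.mk0 _ (right_ne_zero_of_mul hdet), ?_⟩
    ext i j
    fin_cases i <;> fin_cases j <;> simp [h1, h2, h3]
  rcases exists_pow_or_apply_eq_mul hP zero_ne_one hφP with ⟨v, hv⟩ | ⟨c, hc⟩
  · exact ⟨P, v, fun g hg => hmem g v (hP g hg).1 (hP g hg).2 (hv g hg)⟩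
  rcases exists_pow_or_apply_eq_mul hP one_ne_zero hφP with ⟨v, hv⟩ | ⟨c', hc'⟩
  -- The relation holds with the characters exchanged; swapping the coordinates restores the
  -- standard form.
  · let S : GL (Fin 2) k := Matrix.GeneralLinearGroup.mkOfDetNeZero !![0, 1; 1, 0] (by simp)
    have hS : (S : Matrix (Fin 2) (Fin 2) k) = !![0, 1; 1, 0] := rfl
    have hS' : S⁻¹ = S := inv_eq_of_mul_eq_one_right (Units.ext (by
      rw [Units.val_mul, hS, Units.val_one, Matrix.one_fin_two]; simp))
    refine ⟨S * P, v, ?_⟩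
    rintro _ ⟨g, hg, rfl⟩
    have h1 : MulAut.conj P g ∈ G.map (MulAut.conj P).toMonoidHom := Subgroup.mem_map_of_mem _ hg
    change MulAut.conj (S * P) g ∈ _
    rw [map_mul, MulAut.mul_apply]
    have h2 := hP _ h1
    have h3 := hv _ h1
    set g' := MulAut.conj P g
    have h4 : ((MulAut.conj S g' : GL (Fin 2) k) : Matrix (Fin 2) (Fin 2) k) =
        !![(g' : Matrix (Fin 2) (Fin 2) k) 1 1, (g' : Matrix (Fin 2) (Fin 2) k) 1 0;
          (g' : Matrix (Fin 2) (Fin 2) k) 0 1, (g' : Matrix (Fin 2) (Fin 2) k) 0 0] := by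
      rw [MulAut.conj_apply, hS', Units.val_mul, Units.val_mul, hS]
      ext i j
      fin_cases i <;> fin_cases j <;> simp [Matrix.mul_apply, Matrix.vecMul, dotProduct, Fin.sum_univ_two]
    refine hmem _ v ?_ ?_ ?_ <;> rw [h4] <;> simp [h2, h3]
  · exfalso
    have h1 : MulAut.conj (linearPerm k 2 P) φ ∈ (linearPerm k 2).range := by
      refine mem_range_linearPerm_of_forall_eq_mulVec !![c, 0; 0, c'] fun z => funext fun i => ?_
      generalize MulAut.conj (linearPerm k 2 P) φ = ψ at hc hc' ⊢
      fin_cases i <;> simp [hc, hc', Matrix.mulVec, dotProduct, Fin.sum_univ_two]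
    obtain ⟨M, hM⟩ := h1
    refine hl ⟨P⁻¹ * M * P, ?_⟩
    rw [map_mul, map_mul, hM, map_inv, MulAut.conj_apply]
    group

/-- A Zariski closed noncyclic group that is conjugate into a weighted torus is conjugate to it. -/
theorem map_conj_eq_range_weightedTorus (hG : IsZariskiClosed (G : Set (GL (Fin 2) k)))
    (hcyc : ¬ IsCyclic G) {P : GL (Fin 2) k} {v : ℕ}
    (h : G.map (MulAut.conj P).toMonoidHom ≤ (weightedTorus k v).range) :
    G.map (MulAut.conj P).toMonoidHom = (weightedTorus k v).range := by
  refine le_antisymm h ?_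
  obtain ⟨I, hI⟩ := hG
  -- The equation `p` pulled back to the torus: a polynomial in `l`, through the entries of `P⁻¹
  -- diag(l ^ v, l) P`. Either all these polynomials vanish and `G` contains the conjugated torus,
  -- or one of them has only finitely many roots.
  let f : MvPolynomial (Fin 2 × Fin 2) k → Polynomial k := fun p => aeval (fun ij =>
    Polynomial.C ((P⁻¹ : GL (Fin 2) k) ij.1 0 * P 0 ij.2) * Polynomial.X ^ v +
    Polynomial.C ((P⁻¹ : GL (Fin 2) k) ij.1 1 * P 1 ij.2) * Polynomial.X) p
  have hconj : ∀ l : kˣ, weightedTorus k v l ∈ G.map (MulAut.conj P).toMonoidHom ↔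
      P⁻¹ * weightedTorus k v l * P ∈ G := by
    intro l
    rw [Subgroup.mem_map_equiv, MulAut.conj_symm_apply]
  have hf : ∀ (l : kˣ) p, (f p).eval (l : k) = eval (fun ij =>
      ((P⁻¹ * weightedTorus k v l * P : GL (Fin 2) k) : Matrix (Fin 2) (Fin 2) k) ij.1 ij.2) p := by
    intro l p
    change (Polynomial.aeval (l : k)) _ = _
    rw [← AlgHom.comp_apply, comp_aeval]
    have : (fun ij : Fin 2 × Fin 2 => (Polynomial.aeval (l : k))
        (Polynomial.C ((P⁻¹ : GL (Fin 2) k) ij.1 0 * P 0 ij.2) * Polynomial.X ^ v +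
        Polynomial.C ((P⁻¹ : GL (Fin 2) k) ij.1 1 * P 1 ij.2) * Polynomial.X)) = fun ij =>
        ((P⁻¹ * weightedTorus k v l * P : GL (Fin 2) k) : Matrix (Fin 2) (Fin 2) k) ij.1 ij.2 := by
      funext ij
      rw [Units.val_mul, Units.val_mul, coe_weightedTorus]
      change Polynomial.eval (l : k) _ = _
      simp only [Matrix.mul_apply, Fin.sum_univ_two]
      simp
      ring
    rw [this]
    rfl
  by_cases hI0 : ∀ p ∈ I, f p = 0
  · rintro _ ⟨l, rfl⟩
    rw [hconj, ← SetLike.mem_coe, hI]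
    intro p hp
    rw [← hf, hI0 p hp, Polynomial.eval_zero]
  · exfalso
    push Not at hI0
    obtain ⟨p, hp, hp0⟩ := hI0
    set H := (G.map (MulAut.conj P).toMonoidHom).comap (weightedTorus k v)
    have hfin : Finite H := by
      have h1 : ((fun l : kˣ => (l : k)) '' (H : Set kˣ)).Finite := by
        refine (Polynomial.finite_setOfPred_isRoot hp0).subset ?_
        rintro _ ⟨l, hl, rfl⟩
        have h2 := (hconj l).1 hl
        rw [← SetLike.mem_coe, hI] at h2
        exact (hf l p).trans (h2 p hp)
      exact (Set.Finite.of_finite_image h1 Units.val_injective.injOn).to_subtype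
    have hmap : H.map (weightedTorus k v) = G.map (MulAut.conj P).toMonoidHom :=
      Subgroup.map_comap_eq_self h
    have e1 : G ≃* G.map (MulAut.conj P).toMonoidHom :=
      G.equivMapOfInjective _ (MulAut.conj P).injective
    have e2 : H ≃* H.map (weightedTorus k v) :=
      H.equivMapOfInjective _ (weightedTorus_injective v)
    rw [hmap] at e2
    -- A finite subgroup of `kˣ` is cyclic.
    have hH : IsCyclic H := inferInstance
    exact hcyc (isCyclic_of_surjective (e2.trans e1.symm) (e2.trans e1.symm).surjective)

/-- Automorphisms that commute with all scalars are linear. -/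
theorem mem_range_linearPerm_of_scalar [CharZero k] {φ : Equiv.Perm (Fin 2 → k)}
    (hφ : φ ∈ equivariantAut (weightedTorus k 1).range) : φ ∈ (linearPerm k 2).range := by
  obtain ⟨⟨⟨p, hp⟩, -⟩, hG⟩ := mem_equivariantAut_iff.1 hφ
  refine mem_range_linearPerm_of_homogeneousComponent p hp fun d hd i => ?_
  -- One scalar of infinite order suffices: in characteristic zero, `2 ^ d = 2` only for `d = 1`.
  let two : kˣ := Units.mk0 2 two_ne_zero
  have h1 : ∀ z, eval (fun i => 2 * z i) (p i) = 2 * eval z (p i) := by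
    intro z
    have h2 := hG _ ⟨two, rfl⟩ z
    have h3 : ∀ z, (weightedTorus k 1 two : Matrix (Fin 2) (Fin 2) k).mulVec z =
        fun i => 2 * z i := by
      intro z
      rw [coe_weightedTorus_mulVec]
      funext i
      fin_cases i <;> simp [two]
    rw [h3, h3] at h2
    rw [← hp, h2, ← hp]
  ext s
  rw [coeff_homogeneousComponent, coeff_zero]
  split_ifs with hs
  · have h2 := prod_pow_mul_coeff_of_eval_mul h1 s
    rw [Finset.prod_pow_eq_pow_sum, ← Finsupp.degree_eq_sum, hs] at h2
    by_contra h0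
    have h3 := mul_right_cancel₀ h0 h2
    have h4 : 2 ^ d = 2 := by exact_mod_cast h3
    exact hd (Nat.pow_right_injective le_rfl (h4.trans (pow_one 2).symm))
  · rfl

end Diagonal

/-! ### Automorphisms commuting with a weighted torus. -/

section WeightedTorus

variable {k : Type*} [Field k]

/-- The exponents of the monomials in the components of an automorphism commuting with a weighted
torus. -/
theorem weight_eq_of_mem_support [CharZero k] {v m : ℕ} {p : MvPolynomial (Fin 2) k}
    (h : ∀ z, eval ![2 ^ v * z 0, 2 * z 1] p = 2 ^ m * eval z p) {s : Fin 2 →₀ ℕ}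
    (hs : s ∈ p.support) : v * s 0 + s 1 = m := by
  have h1 := prod_pow_mul_coeff_of_eval_mul (c := ![2 ^ v, 2]) (a := (2 : k) ^ m) (p := p) (q := p)
    (fun z => by
      rw [← h]
      congr 2
      funext i
      fin_cases i <;> simp) s
  have h2 := mul_right_cancel₀ (mem_support_iff.1 hs) h1
  rw [Fin.prod_univ_two] at h2
  have h3 : (2 : k) ^ (v * s 0 + s 1) = 2 ^ m := by
    rw [← h2, pow_add, pow_mul]; rfl
  exact Nat.pow_right_injective le_rfl (by exact_mod_cast h3)

theorem exists_eval_eq_of_weight {v : ℕ} (hv : 2 ≤ v) {p : MvPolynomial (Fin 2) k}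
    (h : ∀ s ∈ p.support, v * s 0 + s 1 = v) :
    ∃ a b : k, ∀ z, eval z p = a * z 0 + b * z 1 ^ v := by
  classical
  let e : Fin 2 →₀ ℕ := Finsupp.single 0 1
  let f : Fin 2 →₀ ℕ := Finsupp.single 1 v
  have hsub : p.support ⊆ {e, f} := by
    intro s hs
    have h1 := h s hs
    rw [Finset.mem_insert, Finset.mem_singleton]
    rcases Nat.eq_zero_or_pos (s 0) with h0 | h0
    · right
      ext i
      fin_cases i
      · simpa [f] using h0
      · simpa [f, h0] using h1
    · left
      have h2 : s 0 = 1 := by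
        refine le_antisymm ?_ h0
        by_contra! h3
        have : v * 2 ≤ v * s 0 := Nat.mul_le_mul_left _ h3
        omega
      ext i
      fin_cases i
      · simpa [e] using h2
      · simpa [e, h2] using h1
  have hef : e ≠ f := by
    intro h1
    have := DFunLike.congr_fun h1 0
    simp [e, f] at this
  refine ⟨p.coeff e, p.coeff f, fun z => ?_⟩
  rw [eval_eq', Finset.sum_subset hsub, Finset.sum_pair hef]
  · simp [e, f, Fin.prod_univ_two]
  · intro s _ hs
    rw [notMem_support_iff.1 hs, zero_mul]

theorem exists_eval_eq_of_weight_one {v : ℕ} (hv : 2 ≤ v) {p : MvPolynomial (Fin 2) k}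
    (h : ∀ s ∈ p.support, v * s 0 + s 1 = 1) : ∃ a : k, ∀ z, eval z p = a * z 1 := by
  let e : Fin 2 →₀ ℕ := Finsupp.single 1 1
  have hsub : p.support ⊆ {e} := by
    intro s hs
    have h1 := h s hs
    rw [Finset.mem_singleton]
    have h0 : s 0 = 0 := by
      by_contra h3
      have : v * 1 ≤ v * s 0 := Nat.mul_le_mul_left _ (Nat.pos_of_ne_zero h3)
      omega
    ext i
    fin_cases i
    · simpa [e] using h0
    · simpa [e, h0] using h1
  refine ⟨p.coeff e, fun z => ?_⟩
  rw [eval_eq', Finset.sum_subset hsub, Finset.sum_singleton]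
  · simp [e, Fin.prod_univ_two]
  · intro s _ hs
    rw [notMem_support_iff.1 hs, zero_mul]

theorem exists_eval_eq_of_snd_weight {m : ℕ} {p : MvPolynomial (Fin 2) k}
    (h : ∀ s ∈ p.support, s 1 = m) :
    ∃ f : Polynomial k, ∀ z, eval z p = f.eval (z 0) * z 1 ^ m := by
  refine ⟨∑ s ∈ p.support, Polynomial.C (p.coeff s) * Polynomial.X ^ s 0, fun z => ?_⟩
  rw [eval_eq', Polynomial.eval_finsetSum, Finset.sum_mul]
  refine Finset.sum_congr rfl fun s hs => ?_
  rw [Fin.prod_univ_two, h s hs]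
  simp [mul_assoc]

/-- The element with `l = 2` alone separates weights, since powers of `2` with different exponents
differ in characteristic zero. -/
theorem eval_weightedTorus_two [CharZero k] {v : ℕ} {φ : Equiv.Perm (Fin 2 → k)}
    (hφ : φ ∈ equivariantAut (weightedTorus k v).range) {p : Fin 2 → MvPolynomial (Fin 2) k}
    (hp : ∀ z i, φ z i = eval z (p i)) (z : Fin 2 → k) :
    eval ![2 ^ v * z 0, 2 * z 1] (p 0) = 2 ^ v * eval z (p 0) ∧
      eval ![2 ^ v * z 0, 2 * z 1] (p 1) = 2 ^ 1 * eval z (p 1) := by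
  have h1 := (mem_equivariantAut_iff.1 hφ).2 _ ⟨Units.mk0 2 two_ne_zero, rfl⟩ z
  rw [coe_weightedTorus_mulVec, coe_weightedTorus_mulVec] at h1
  have h2 := congrFun h1 0
  have h3 := congrFun h1 1
  rw [hp] at h2 h3
  exact ⟨by simpa [hp] using h2, by simpa [hp] using h3⟩

/-- An automorphism that commutes with the torus of the maps `(z₁, l z₂)`. -/
theorem exists_eq_of_mem_equivariantAut_weightedTorus_zero [CharZero k]
    {φ : Equiv.Perm (Fin 2 → k)} (hφ : φ ∈ equivariantAut (weightedTorus k 0).range) :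
    ∃ a b c : k, ∀ z, φ z = ![a * z 0 + b, c * z 1] := by
  have key : ∀ φ ∈ equivariantAut (weightedTorus k 0).range,
      ∃ f q : Polynomial k, ∀ z, φ z = ![f.eval (z 0), q.eval (z 0) * z 1] := by
    intro φ hφ
    obtain ⟨⟨⟨p, hp⟩, -⟩, -⟩ := mem_equivariantAut_iff.1 hφ
    have h := eval_weightedTorus_two hφ hp
    obtain ⟨f, hf⟩ := exists_eval_eq_of_snd_weight (p := p 0) (m := 0) fun s hs => by
      simpa using weight_eq_of_mem_support (fun z => (h z).1) hs
    obtain ⟨q, hq⟩ := exists_eval_eq_of_snd_weight (p := p 1) (m := 1) fun s hs => by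
      simpa using weight_eq_of_mem_support (fun z => (h z).2) hs
    refine ⟨f, q, fun z => funext fun i => ?_⟩
    rw [hp]
    fin_cases i
    · simpa using hf z
    · simpa using hq z
  obtain ⟨f, q, hf⟩ := key φ hφ
  obtain ⟨f', q', hf'⟩ := key _ (inv_mem hφ)
  have hinv : ∀ z, φ⁻¹ (φ z) = z := φ.symm_apply_apply
  -- For `v = 0` weights leave `f` and `q` arbitrary, and invertibility bounds them: `f' ∘ f = X`
  -- makes `f` of degree one, and `q` divides one, so it is constant.
  have hcomp : f'.comp f = Polynomial.X := by
    refine Polynomial.funext fun t => ?_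
    have := congrFun (hinv ![t, 0]) 0
    rw [hf', hf] at this
    simpa using this
  have hmul : q'.comp f * q = 1 := by
    refine Polynomial.funext fun t => ?_
    have := congrFun (hinv ![t, 1]) 1
    rw [hf', hf] at this
    simpa using this
  have hdeg : f.natDegree = 1 := by
    have := congrArg Polynomial.natDegree hcomp
    rw [Polynomial.natDegree_comp, Polynomial.natDegree_X] at this
    exact Nat.eq_one_of_mul_eq_one_left this
  obtain ⟨c, -, hc⟩ := Polynomial.isUnit_iff.1 (IsUnit.of_mul_eq_one_right _ hmul)
  refine ⟨f.coeff 1, f.coeff 0, c, fun z => ?_⟩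
  rw [hf, ← hc]
  conv_lhs => rw [Polynomial.eq_X_add_C_of_natDegree_le_one hdeg.le]
  simp

theorem exists_eq_of_mem_equivariantAut_weightedTorus [CharZero k] {v : ℕ} (hv : v ≠ 1)
    {φ : Equiv.Perm (Fin 2 → k)} (hφ : φ ∈ equivariantAut (weightedTorus k v).range) :
    ∃ a b c : k, ∀ z, φ z = ![a * z 0 + b * z 1 ^ v, c * z 1] := by
  rcases Nat.eq_zero_or_pos v with rfl | hpos
  · obtain ⟨a, b, c, h⟩ := exists_eq_of_mem_equivariantAut_weightedTorus_zero hφ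
    exact ⟨a, b, c, fun z => by rw [h, pow_zero, mul_one]⟩
  · have hv2 : 2 ≤ v := by omega
    obtain ⟨⟨⟨p, hp⟩, -⟩, -⟩ := mem_equivariantAut_iff.1 hφ
    have h := eval_weightedTorus_two hφ hp
    obtain ⟨a, b, hab⟩ := exists_eval_eq_of_weight hv2 fun s hs =>
      weight_eq_of_mem_support (fun z => (h z).1) hs
    obtain ⟨c, hc⟩ := exists_eval_eq_of_weight_one hv2 fun s hs =>
      weight_eq_of_mem_support (fun z => (h z).2) hs
    refine ⟨a, b, c, fun z => funext fun i => ?_⟩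
    rw [hp]
    fin_cases i
    · simpa using hab z
    · simpa using hc z

theorem isPolynomialMap_shear (a b c : k) (v : ℕ) :
    IsPolynomialMap fun z : Fin 2 → k => ![a * z 0 + b * z 1 ^ v, c * z 1] :=
  ⟨![C a * X 0 + C b * X 1 ^ v, C c * X 1], fun z i => by fin_cases i <;> simp⟩

theorem mem_equivariantAut_weightedTorus_iff [CharZero k] {v : ℕ} (hv : v ≠ 1)
    {φ : Equiv.Perm (Fin 2 → k)} :
    φ ∈ equivariantAut (weightedTorus k v).range ↔
      ∃ (a₁ a₂ : kˣ) (b : k), ∀ z, φ z = ![(a₁ : k) * z 0 + b * z 1 ^ v, (a₂ : k) * z 1] := by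
  constructor
  · intro hφ
    obtain ⟨a, b, c, h⟩ := exists_eq_of_mem_equivariantAut_weightedTorus hv hφ
    have ha : a ≠ 0 := by
      rintro rfl
      have h1 : φ ![1, 0] = φ ![0, 0] := by rw [h, h]; simp
      simpa using congrFun (φ.injective h1) 0
    have hc : c ≠ 0 := by
      rintro rfl
      obtain ⟨z, hz⟩ := φ.surjective ![0, 1]
      rw [h] at hz
      simpa using congrFun hz 1
    exact ⟨Units.mk0 a ha, Units.mk0 c hc, b, h⟩
  · rintro ⟨a₁, a₂, b, h⟩
    rw [mem_equivariantAut_iff]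
    refine ⟨⟨?_, ?_⟩, ?_⟩
    · rw [show (φ : (Fin 2 → k) → Fin 2 → k) = _ from funext h]
      exact isPolynomialMap_shear _ _ _ _
    · have h1 : (φ.symm : (Fin 2 → k) → Fin 2 → k) = fun z =>
          ![(a₁ : k)⁻¹ * z 0 + -((a₁ : k)⁻¹ * b * ((a₂ : k)⁻¹) ^ v) * z 1 ^ v,
            (a₂ : k)⁻¹ * z 1] := by
        funext z
        rw [Equiv.symm_apply_eq, h]
        have h1 := a₁.ne_zero
        have h2 := a₂.ne_zero
        funext i
        fin_cases i
        · simp [mul_pow]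
          field_simp
          ring
        · simp
      rw [h1]
      exact isPolynomialMap_shear _ _ _ _
    · rintro _ ⟨l, rfl⟩ z
      rw [coe_weightedTorus_mulVec, coe_weightedTorus_mulVec, h, h]
      funext i
      fin_cases i <;> simp <;> ring

/-- The trichotomy for the groups of equivariant automorphisms of the plane, in terms of the
structure of the group. -/
theorem IsReductive.equivariantAut_eq_or_exists_weightedTorus [CharZero k]
    {G : Subgroup (GL (Fin 2) k)} (hG : IsReductive G) (hcyc : ¬ IsCyclic G) :
    equivariantAut G = equivariantGL G ∨ ∃ (P : GL (Fin 2) k) (v : ℕ), v ≠ 1 ∧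
      G.map (MulAut.conj P).toMonoidHom = (weightedTorus k v).range := by
  by_cases hlin : equivariantAut G ≤ (linearPerm k 2).range
  · exact Or.inl (le_antisymm (le_inf hlin le_rfl) inf_le_right)
  · right
    obtain ⟨φ, hφ, hl⟩ := SetLike.not_le_iff_exists.1 hlin
    obtain ⟨P, v, hle⟩ := hG.exists_map_conj_le hφ hl
    have heq := map_conj_eq_range_weightedTorus hG.closed hcyc hle
    refine ⟨P, v, ?_, heq⟩
    -- For `v = 1` the torus is the group of scalars, whose equivariant automorphisms are linear,
    -- contrary to the choice of `φ`.
    rintro rfl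
    have h1 := conj_mem_equivariantAut P hφ
    rw [heq] at h1
    obtain ⟨M, hM⟩ := mem_range_linearPerm_of_scalar h1
    refine hl ⟨P⁻¹ * M * P, ?_⟩
    rw [map_mul, map_mul, hM, map_inv, MulAut.conj_apply]
    group

theorem isWeightedTorus_of_map_conj_eq [CharZero k] {G : Subgroup (GL (Fin 2) k)}
    {P : GL (Fin 2) k} {v : ℕ} (hv : v ≠ 1)
    (h : G.map (MulAut.conj P).toMonoidHom = (weightedTorus k v).range) : IsWeightedTorus G v := by
  refine ⟨⟨?_⟩, P, fun g => ?_, fun φ => ?_⟩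
  · have e1 : G ≃* G.map (MulAut.conj P).toMonoidHom :=
      G.equivMapOfInjective _ (MulAut.conj P).injective
    rw [h] at e1
    exact e1.trans (MonoidHom.ofInjective (weightedTorus_injective v)).symm
  · rw [h, mem_range_weightedTorus]
  · rw [equivariantAut_map_conj, h, mem_equivariantAut_weightedTorus_iff hv]

end WeightedTorus

/-! ### The complex Lie group structure. -/

theorem continuous_autAlgG_apply {n : ℕ} (G : Subgroup (GL (Fin n) ℂ)) (x : Fin n → ℂ) :
    Continuous fun φ : AutAlgG G => φ.1 x := by
  have h : Continuous (AutAlgG.toContinuousMaps G) := continuous_induced_dom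
  exact (continuous_eval_const (F := C(Fin n → ℂ, Fin n → ℂ)) x).comp (continuous_fst.comp h)

/-- A coordinate on `Aut^G` that is linear in the values at finitely many points, through which
automorphisms and inverses are holomorphic, is an open embedding. -/
theorem isOpenEmbedding_of_coordinate {n : ℕ} {G : Subgroup (GL (Fin n) ℂ)}
    {E : Type*} [NormedAddCommGroup E] [NormedSpace ℂ E] {ι : Type*}
    (c : AutAlgG G → E) (hopen : IsOpen (Set.range c))
    (x : ι → Fin n → ℂ) (L : (ι → Fin n → ℂ) →L[ℂ] E) (hc : ∀ φ, c φ = L fun j => φ.1 (x j))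
    (act : E → (Fin n → ℂ) → Fin n → ℂ) (hact : Continuous (Function.uncurry act))
    (hcact : ∀ φ z, φ.1 z = act (c φ) z)
    (inv : E → E) (hinv : ContinuousOn inv (Set.range c)) (hcinv : ∀ φ, c φ⁻¹ = inv (c φ)) :
    Topology.IsOpenEmbedding c := by
  have hcont : Continuous c := by
    rw [show c = fun φ => L fun j => φ.1 (x j) from funext hc]
    exact L.continuous.comp (continuous_pi fun j => continuous_autAlgG_apply G (x j))
  have hinj : Function.Injective c := by
    intro φ ψ h
    refine Subtype.ext (Equiv.ext fun z => ?_)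
    rw [hcact, hcact, h]
  let c' : AutAlgG G → Set.range c := fun φ => ⟨c φ, φ, rfl⟩
  have hc' : Continuous c' := hcont.subtype_mk _
  have hact1 : ∀ e, Continuous (act e) := fun e => hact.comp (Continuous.prodMk_right e)
  let F : Set.range c → C(Fin n → ℂ, Fin n → ℂ) × C(Fin n → ℂ, Fin n → ℂ) :=
    fun e => (⟨act e.1, hact1 _⟩, ⟨act (inv e.1), hact1 _⟩)
  have hF : Continuous F := by
    refine Continuous.prodMk ?_ ?_
    · refine ContinuousMap.continuous_of_continuous_uncurry _ ?_
      exact hact.comp ((continuous_subtype_val.comp continuous_fst).prodMk continuous_snd)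
    · refine ContinuousMap.continuous_of_continuous_uncurry _ ?_
      exact hact.comp (((continuousOn_iff_continuous_domRestrict.1 hinv).comp continuous_fst).prodMk
        continuous_snd)
  have hFc : F ∘ c' = AutAlgG.toContinuousMaps G := by
    funext φ
    refine Prod.ext (ContinuousMap.ext fun z => (hcact φ z).symm) (ContinuousMap.ext fun z => ?_)
    change act (inv (c φ)) z = (φ⁻¹).1 z
    rw [hcact, hcinv]
  -- Joint continuity of `act` makes `F` continuous for locally uniform convergence, so the given
  -- topology is no finer than that of the coordinate; continuity of evaluations gives the converse.
  have hind : Topology.IsInducing c' :=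
    Topology.IsInducing.of_comp hc' hF (by rw [hFc]; exact ⟨rfl⟩)
  exact ⟨⟨Topology.IsInducing.subtypeVal.comp hind, hinj⟩, hopen⟩

/-- The coordinate is a single global chart. Multiplication is holomorphic because the coordinate of
a product is `L` applied to the values `act (c φ) (act (c ψ) (x j))`. -/
theorem isConnectedLieGroup_of_coordinate {n d : ℕ} {G : Subgroup (GL (Fin n) ℂ)} {ι : Type*}
    [Fintype ι] (c : AutAlgG G → EuclideanSpace ℂ (Fin d)) (hopen : IsOpen (Set.range c))
    (hconn : IsConnected (Set.range c))
    (x : ι → Fin n → ℂ) (L : (ι → Fin n → ℂ) →L[ℂ] EuclideanSpace ℂ (Fin d))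
    (hc : ∀ φ, c φ = L fun j => φ.1 (x j))
    (act : EuclideanSpace ℂ (Fin d) → (Fin n → ℂ) → Fin n → ℂ)
    (hact : ContDiff ℂ ω (Function.uncurry act)) (hcact : ∀ φ z, φ.1 z = act (c φ) z)
    (inv : EuclideanSpace ℂ (Fin d) → EuclideanSpace ℂ (Fin d))
    (hinv : ContDiffOn ℂ ω inv (Set.range c)) (hcinv : ∀ φ, c φ⁻¹ = inv (c φ)) :
    IsConnectedLieGroup G := by
  have h : Topology.IsOpenEmbedding c :=
    isOpenEmbedding_of_coordinate c hopen x L hc act hact.continuous hcact inv hinv.continuousOn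
      hcinv
  let cs : ChartedSpace (EuclideanSpace ℂ (Fin d)) (AutAlgG G) := h.singletonChartedSpace
  have hcM : ContMDiff 𝓘(ℂ, EuclideanSpace ℂ (Fin d)) 𝓘(ℂ, EuclideanSpace ℂ (Fin d)) ω c :=
    contMDiff_isOpenEmbedding h
  have hman : IsManifold 𝓘(ℂ, EuclideanSpace ℂ (Fin d)) ω (AutAlgG G) := h.isManifold_singleton
  have hmul : ContMDiff (𝓘(ℂ, EuclideanSpace ℂ (Fin d)).prod 𝓘(ℂ, EuclideanSpace ℂ (Fin d)))
      𝓘(ℂ, EuclideanSpace ℂ (Fin d)) ω (fun p : AutAlgG G × AutAlgG G => p.1 * p.2) := by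
    refine ContMDiff.of_comp_isOpenEmbedding h ?_
    have h1 : (c ∘ fun p : AutAlgG G × AutAlgG G => p.1 * p.2) =
        (fun e : EuclideanSpace ℂ (Fin d) × EuclideanSpace ℂ (Fin d) =>
          L fun j => act e.1 (act e.2 (x j))) ∘ fun p => (c p.1, c p.2) := by
      funext p
      refine (hc _).trans (congrArg L (funext fun j => ?_))
      change p.1.1 (p.2.1 (x j)) = _
      rw [hcact, hcact]
    rw [h1]
    have h2 : ContDiff ℂ ω (fun e : EuclideanSpace ℂ (Fin d) × EuclideanSpace ℂ (Fin d) =>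
        L fun j => act e.1 (act e.2 (x j))) := by
      refine L.contDiff.comp (contDiff_pi.2 fun j => ?_)
      exact hact.comp (contDiff_fst.prodMk (hact.comp (contDiff_snd.prodMk contDiff_const)))
    exact h2.contMDiff.comp
      ((hcM.comp contMDiff_fst).prodMk_space (hcM.comp contMDiff_snd))
  have hinvM : ContMDiff 𝓘(ℂ, EuclideanSpace ℂ (Fin d)) 𝓘(ℂ, EuclideanSpace ℂ (Fin d)) ω
      (fun φ : AutAlgG G => φ⁻¹) := by
    refine ContMDiff.of_comp_isOpenEmbedding h ?_
    rw [show (c ∘ fun φ : AutAlgG G => φ⁻¹) = inv ∘ c from funext hcinv]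
    exact hinv.contMDiffOn.comp_contMDiff hcM fun φ => ⟨φ, rfl⟩
  refine ⟨d, cs, ?_, h.isEmbedding.t2Space, h.isEmbedding.secondCountableTopology, ?_, ?_⟩
  · exact { hman with
      contMDiff_mul := hmul
      contMDiff_inv := hinvM }
  · rw [connectedSpace_iff_univ]
    refine ⟨Set.univ_nonempty, h.isInducing.isPreconnected_image.1 ?_⟩
    rw [Set.image_univ]
    exact hconn.isPreconnected
  · have h1 : (fun p : AutAlgG G × (Fin n → ℂ) => p.1.1 p.2) =
        Function.uncurry act ∘ fun p => (c p.1, p.2) := funext fun p => hcact _ _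
    rw [h1]
    exact hact.contMDiff.comp ((hcM.comp contMDiff_fst).prodMk_space contMDiff_snd)

/-- The complement of a quadric of the form `f₀ f₁ = f₂ f₃` in a complex vector space is
connected. -/
theorem isConnected_setOf_mul_sub_mul_ne_zero {E : Type*} [NormedAddCommGroup E] [NormedSpace ℂ E]
    (f₀ f₁ f₂ f₃ : E →L[ℂ] ℂ) (hne : ∃ e, f₀ e * f₁ e - f₂ e * f₃ e ≠ 0) :
    IsConnected {e | f₀ e * f₁ e - f₂ e * f₃ e ≠ 0} := by
  obtain ⟨e₀, he₀⟩ := hne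
  refine ⟨⟨e₀, he₀⟩, isPreconnected_of_forall e₀ fun e he => ?_⟩
  -- On the complex line through two points of the complement, the quadric has finitely many zeros,
  -- and `ℂ` minus a finite set is connected.
  let γ : ℂ → E := fun t => e₀ + t • (e - e₀)
  have hγ : Continuous γ := by fun_prop
  let lin : (E →L[ℂ] ℂ) → Polynomial ℂ := fun f =>
    Polynomial.C (f e₀) + Polynomial.X * Polynomial.C (f (e - e₀))
  have hlin : ∀ f t, (lin f).eval t = f (γ t) := fun f t => by simp [lin, γ]
  let p : Polynomial ℂ := lin f₀ * lin f₁ - lin f₂ * lin f₃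
  have hp : ∀ t, p.eval t = f₀ (γ t) * f₁ (γ t) - f₂ (γ t) * f₃ (γ t) := fun t => by
    simp only [p, Polynomial.eval_sub, Polynomial.eval_mul, hlin]
  have hγ0 : γ 0 = e₀ := by simp [γ]
  have hγ1 : γ 1 = e := by simp [γ]
  have hp0 : p ≠ 0 := by
    intro h0
    have := hp 0
    rw [h0, Polynomial.eval_zero, hγ0] at this
    exact he₀ this.symm
  have hconn : IsPathConnected {t | p.IsRoot t}ᶜ :=
    (Polynomial.finite_setOfPred_isRoot hp0).countable.isPathConnected_compl_of_one_lt_rank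
      (by rw [Complex.rank_real_complex]; exact Nat.one_lt_ofNat)
  refine ⟨γ '' {t | p.IsRoot t}ᶜ, ?_, ⟨0, ?_, hγ0⟩, ⟨1, ?_, hγ1⟩,
    hconn.isConnected.isPreconnected.image _ hγ.continuousOn⟩
  · rintro _ ⟨t, ht, rfl⟩
    change _ ≠ _
    rw [← hp]
    exact ht
  · change ¬ (p.eval 0 = 0)
    rw [hp, hγ0]; exact he₀
  · change ¬ (p.eval 1 = 0)
    rw [hp, hγ1]; exact he

theorem isOpen_setOf_mul_sub_mul_ne_zero {E : Type*} [NormedAddCommGroup E] [NormedSpace ℂ E]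
    (f₀ f₁ f₂ f₃ : E →L[ℂ] ℂ) : IsOpen {e | f₀ e * f₁ e - f₂ e * f₃ e ≠ 0} :=
  isOpen_ne_fun (by fun_prop) (by fun_prop)

/-- The group is identified with the invertible elements of the commutant of `G`, the part of a
vector space of matrices where the determinant is nonzero. -/
theorem isConnectedLieGroup_of_linear {G : Subgroup (GL (Fin 2) ℂ)}
    (hlin : equivariantAut G ≤ (linearPerm ℂ 2).range) : IsConnectedLieGroup G := by
  let A : Submodule ℂ (Matrix (Fin 2) (Fin 2) ℂ) :=
    { carrier := {M | ∀ g ∈ G, M * (g : Matrix (Fin 2) (Fin 2) ℂ) = g * M}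
      add_mem' := fun {a b} ha hb g hg => by rw [add_mul, mul_add, ha g hg, hb g hg]
      zero_mem' := fun g _ => by rw [zero_mul, mul_zero]
      smul_mem' := fun t a ha g hg => by rw [smul_mul_assoc, mul_smul_comm, ha g hg] }
  let d := Module.finrank ℂ A
  let e : A ≃ₗ[ℂ] EuclideanSpace ℂ (Fin d) := LinearEquiv.ofFinrankEq _ _ (by simp [d])
  let ι : EuclideanSpace ℂ (Fin d) →ₗ[ℂ] Matrix (Fin 2) (Fin 2) ℂ := A.subtype ∘ₗ e.symm.toLinearMap
  obtain ⟨ρ, hρ⟩ := LinearMap.exists_leftInverse_of_injective ι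
    (LinearMap.ker_eq_bot.2 (Subtype.val_injective.comp e.symm.injective))
  have hρι : ∀ u, ρ (ι u) = u := fun u => LinearMap.congr_fun hρ u
  have hιρ : ∀ M ∈ A, ι (ρ M) = M := by
    intro M hM
    have h1 : ι (e ⟨M, hM⟩) = M := by simp [ι]
    rw [← h1, hρι]
  have hιA : ∀ u, ι u ∈ A := fun u => (e.symm u).2
  let f : Fin 2 → Fin 2 → EuclideanSpace ℂ (Fin d) →L[ℂ] ℂ := fun i j =>
    LinearMap.toContinuousLinearMap (Matrix.entryLinearMap ℂ ℂ i j ∘ₗ ι)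
  have hf : ∀ i j u, f i j u = ι u i j := fun i j u => rfl
  let R : (Fin 2 → Fin 2 → ℂ) →L[ℂ] EuclideanSpace ℂ (Fin d) := LinearMap.toContinuousLinearMap
    (ρ ∘ₗ (Matrix.transposeLinearEquiv (Fin 2) (Fin 2) ℂ ℂ).toLinearMap ∘ₗ
      (Matrix.ofLinearEquiv ℂ).toLinearMap)
  have hR : ∀ y, R y = ρ (Matrix.of y).transpose := fun y => rfl
  -- The images of the basis vectors are the columns of the matrix; `ρ` sends the matrix to its
  -- coordinates in the commutant.
  let c : AutAlgG G → EuclideanSpace ℂ (Fin d) := fun φ => R fun j => φ.1 (Pi.single j 1)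
  have hcM : ∀ (φ : AutAlgG G) (g : GL (Fin 2) ℂ), linearPerm ℂ 2 g = φ.1 →
      c φ = ρ g ∧ ι (c φ) = g := by
    intro φ g hg
    have h1 : c φ = ρ g := by
      change R _ = _
      rw [hR]
      congr 1
      ext i j
      rw [Matrix.transpose_apply, Matrix.of_apply, ← hg, linearPerm_apply,
        Matrix.mulVec_single_one]
      rfl
    refine ⟨h1, ?_⟩
    rw [h1]
    refine hιρ _ fun a ha => ?_
    refine Matrix.ext_of_mulVec_single fun i => ?_
    have h2 := (mem_equivariantAut_iff.1 φ.2).2 a ha (Pi.single i 1)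
    change φ.1 _ = _ at h2
    rw [← hg, linearPerm_apply, linearPerm_apply] at h2
    rw [← Matrix.mulVec_mulVec, ← Matrix.mulVec_mulVec]
    exact h2
  have hdet : ∀ u, (ι u).det = f 0 0 u * f 1 1 u - f 0 1 u * f 1 0 u := fun u =>
    Matrix.det_fin_two _
  have hrange : Set.range c = {u | f 0 0 u * f 1 1 u - f 0 1 u * f 1 0 u ≠ 0} := by
    ext u
    change _ ↔ _ ≠ _
    rw [← hdet]
    constructor
    · rintro ⟨φ, rfl⟩
      obtain ⟨g, hg⟩ := hlin φ.2
      rw [(hcM φ g hg).2]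
      exact ((Matrix.isUnit_iff_isUnit_det _).1 g.isUnit).ne_zero
    · intro hu
      let g : GL (Fin 2) ℂ := Matrix.GeneralLinearGroup.mkOfDetNeZero (ι u) hu
      have hgφ : linearPerm ℂ 2 g ∈ equivariantAut G := by
        refine mem_equivariantAut_iff.2 ⟨linearPerm_mem_polyAut g, fun a ha z => ?_⟩
        rw [linearPerm_apply, linearPerm_apply, Matrix.mulVec_mulVec, Matrix.mulVec_mulVec]
        exact congrArg (fun M => M.mulVec z) (hιA u a ha)
      refine ⟨⟨_, hgφ⟩, ?_⟩
      rw [(hcM ⟨_, hgφ⟩ g rfl).1]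
      exact hρι u
  have hopen : IsOpen (Set.range c) := hrange ▸ isOpen_setOf_mul_sub_mul_ne_zero _ _ _ _
  have hconn : IsConnected (Set.range c) := by
    rw [hrange]
    refine isConnected_setOf_mul_sub_mul_ne_zero _ _ _ _ ⟨c 1, ?_⟩
    have : c 1 ∈ Set.range c := ⟨1, rfl⟩
    rwa [hrange] at this
  refine isConnectedLieGroup_of_coordinate c hopen hconn (fun j => Pi.single j 1) R (fun φ => rfl)
    (fun u z i => ∑ j, f i j u * z j) ?_ ?_
    -- Inversion is the adjugate over the determinant; the adjugate is listed by columns because `R`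
    -- transposes.
    (fun u => (f 0 0 u * f 1 1 u - f 0 1 u * f 1 0 u)⁻¹ •
      R ![![f 1 1 u, -f 1 0 u], ![-f 0 1 u, f 0 0 u]]) ?_ ?_
  · refine contDiff_pi.2 fun i => ?_
    change ContDiff ℂ ω fun q : EuclideanSpace ℂ (Fin d) × (Fin 2 → ℂ) => ∑ j, f i j q.1 * q.2 j
    exact ContDiff.sum fun j _ =>
      ((f i j).contDiff.comp contDiff_fst).mul ((contDiff_apply ℂ ℂ j).comp contDiff_snd)
  · intro φ z
    obtain ⟨g, hg⟩ := hlin φ.2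
    funext i
    rw [← hg, linearPerm_apply]
    simp only [hf, (hcM φ g hg).2]
    rfl
  · have hD : ContDiff ℂ ω fun u => f 0 0 u * f 1 1 u - f 0 1 u * f 1 0 u :=
      ((f 0 0).contDiff.mul (f 1 1).contDiff).sub ((f 0 1).contDiff.mul (f 1 0).contDiff)
    have hadj : ContDiff ℂ ω fun u => R ![![f 1 1 u, -f 1 0 u], ![-f 0 1 u, f 0 0 u]] := by
      refine R.contDiff.comp (contDiff_pi.2 fun i => contDiff_pi.2 fun j => ?_)
      fin_cases i <;> fin_cases j
      · exact (f 1 1).contDiff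
      · exact (f 1 0).contDiff.neg
      · exact (f 0 1).contDiff.neg
      · exact (f 0 0).contDiff
    exact (hD.contDiffOn.inv fun u hu => by rwa [hrange] at hu).smul hadj.contDiffOn
  · intro φ
    obtain ⟨g, hg⟩ := hlin φ.2
    have hg' : linearPerm ℂ 2 g⁻¹ = (φ⁻¹).1 := by
      rw [map_inv, hg]; rfl
    rw [(hcM _ _ hg').1]
    simp only [hf, (hcM φ g hg).2]
    rw [hR, ← map_smul, Matrix.coe_units_inv, Matrix.inv_def, Matrix.adjugate_fin_two,
      Ring.inverse_eq_inv', Matrix.det_fin_two]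
    refine congrArg ρ (congrArg₂ (· • ·) rfl ?_)
    ext i j
    fin_cases i <;> fin_cases j <;> rfl

theorem isConnectedLieGroup_of_weightedTorus {G : Subgroup (GL (Fin 2) ℂ)} {P : GL (Fin 2) ℂ}
    {v : ℕ} (hv : v ≠ 1)
    (h : G.map (MulAut.conj P).toMonoidHom = (weightedTorus ℂ v).range) :
    IsConnectedLieGroup G := by
  let Q : Matrix (Fin 2) (Fin 2) ℂ := (P⁻¹ : GL (Fin 2) ℂ)
  let P' : Matrix (Fin 2) (Fin 2) ℂ := P
  have hPQ : ∀ z, P'.mulVec (Q.mulVec z) = z := fun z => (linearPerm ℂ 2 P).apply_symm_apply z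
  have hQP : ∀ z, Q.mulVec (P'.mulVec z) = z := fun z => (linearPerm ℂ 2 P).symm_apply_apply z
  let act : EuclideanSpace ℂ (Fin 3) → (Fin 2 → ℂ) → Fin 2 → ℂ := fun u z => Q.mulVec
    ![u 0 * P'.mulVec z 0 + u 1 * P'.mulVec z 1 ^ v, u 2 * P'.mulVec z 1]
  have hshear : ∀ φ : Equiv.Perm (Fin 2 → ℂ), φ ∈ equivariantAut G ↔
      ∃ u : EuclideanSpace ℂ (Fin 3), u 0 ≠ 0 ∧ u 2 ≠ 0 ∧ ∀ z, φ z = act u z := by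
    intro φ
    have h1 : φ ∈ equivariantAut G ↔
        MulAut.conj (linearPerm ℂ 2 P) φ ∈ equivariantAut (weightedTorus ℂ v).range := by
      rw [← h, ← equivariantAut_map_conj]
      exact (Subgroup.mem_map_iff_mem (MulAut.conj (linearPerm ℂ 2 P)).injective).symm
    have h2 : ∀ z, MulAut.conj (linearPerm ℂ 2 P) φ z = P'.mulVec (φ (Q.mulVec z)) := fun z => rfl
    rw [h1, mem_equivariantAut_weightedTorus_iff hv]
    constructor
    · rintro ⟨a₁, a₂, b, h3⟩
      refine ⟨!₂[(a₁ : ℂ), b, (a₂ : ℂ)], a₁.ne_zero, a₂.ne_zero, fun z => ?_⟩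
      have h4 := h3 (P'.mulVec z)
      rw [h2, hQP] at h4
      rw [← hQP (φ z), h4]
      rfl
    · rintro ⟨u, hu0, hu2, h3⟩
      refine ⟨Units.mk0 _ hu0, Units.mk0 _ hu2, u 1, fun z => ?_⟩
      rw [h2, h3]
      simp only [act]
      rw [hPQ, hPQ]
      rfl
  -- Recovers `(a₁, b, a₂)` from the values at `(1, 0)`, `(0, 1)` and the origin, in the coordinates
  -- given by `P`. The value at the origin is subtracted because for `v = 0` the first value
  -- contains the translation `b`.
  let R₀ : (Fin 3 → Fin 2 → ℂ) →ₗ[ℂ] EuclideanSpace ℂ (Fin 3) :=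
    { toFun := fun y => !₂[P'.mulVec (y 0) 0 - P'.mulVec (y 2) 0, P'.mulVec (y 1) 0,
        P'.mulVec (y 1) 1]
      map_add' := fun y y' => by
        ext i
        fin_cases i <;> simp [Matrix.mulVec_add]
        ring
      map_smul' := fun t y => by
        ext i
        fin_cases i <;> simp [Matrix.mulVec_smul, mul_sub] }
  let R : (Fin 3 → Fin 2 → ℂ) →L[ℂ] EuclideanSpace ℂ (Fin 3) := LinearMap.toContinuousLinearMap R₀
  let x : Fin 3 → Fin 2 → ℂ := ![Q.mulVec ![1, 0], Q.mulVec ![0, 1], Q.mulVec ![0, 0]]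
  let c : AutAlgG G → EuclideanSpace ℂ (Fin 3) := fun φ => R fun j => φ.1 (x j)
  have hcu : ∀ (φ : AutAlgG G) (u : EuclideanSpace ℂ (Fin 3)), (∀ z, φ.1 z = act u z) → c φ = u := by
    intro φ u hu
    have hP : ∀ z, P'.mulVec (φ.1 (Q.mulVec z)) = ![u 0 * z 0 + u 1 * z 1 ^ v, u 2 * z 1] := by
      intro z
      rw [hu]
      simp only [act]
      rw [hPQ, hPQ]
    have hc : c φ = !₂[P'.mulVec (φ.1 (Q.mulVec ![1, 0])) 0 - P'.mulVec (φ.1 (Q.mulVec ![0, 0])) 0,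
      P'.mulVec (φ.1 (Q.mulVec ![0, 1])) 0, P'.mulVec (φ.1 (Q.mulVec ![0, 1])) 1] := rfl
    rw [hc, hP, hP, hP]
    ext i
    fin_cases i <;> simp
  have hcact : ∀ (φ : AutAlgG G), c φ 0 ≠ 0 ∧ c φ 2 ≠ 0 ∧ ∀ z, φ.1 z = act (c φ) z := by
    intro φ
    obtain ⟨u, hu0, hu2, hu⟩ := (hshear φ.1).1 φ.2
    rw [hcu φ u hu]
    exact ⟨hu0, hu2, hu⟩
  let inv : EuclideanSpace ℂ (Fin 3) → EuclideanSpace ℂ (Fin 3) := fun u =>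
    !₂[(u 0)⁻¹, -((u 0)⁻¹ * u 1 * ((u 2)⁻¹) ^ v), (u 2)⁻¹]
  have hinv : ∀ u : EuclideanSpace ℂ (Fin 3), u 0 ≠ 0 → u 2 ≠ 0 → ∀ z, act (inv u) (act u z) = z ∧
      act u (act (inv u) z) = z := by
    intro u hu0 hu2 z
    simp only [act]
    rw [hPQ, hPQ]
    constructor
    · rw [← hQP z, hPQ]
      congr 1
      funext i
      fin_cases i
      · simp [inv, mul_pow]
        field_simp
        ring
      · simp [inv, hu2]
    · rw [← hQP z, hPQ]
      congr 1
      funext i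
      fin_cases i
      · simp [inv, mul_pow]
        field_simp
        ring
      · simp [inv, hu2]
  let f : Fin 3 → EuclideanSpace ℂ (Fin 3) →L[ℂ] ℂ := fun i => EuclideanSpace.proj i
  -- The zero functional writes `u 0 * u 2 ≠ 0` as the complement of a quadric of the required form.
  let f₀ : EuclideanSpace ℂ (Fin 3) →L[ℂ] ℂ := 0
  have hrange : Set.range c = {u | f 0 u * f 2 u - f₀ u * f₀ u ≠ 0} := by
    ext u
    have h1 : u ∈ {u | f 0 u * f 2 u - f₀ u * f₀ u ≠ 0} ↔
        u 0 ≠ 0 ∧ u 2 ≠ 0 := by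
      change _ ≠ _ ↔ _
      simp [f, f₀]
    rw [h1]
    constructor
    · rintro ⟨φ, rfl⟩
      exact ⟨(hcact φ).1, (hcact φ).2.1⟩
    · rintro ⟨hu0, hu2⟩
      let φ : Equiv.Perm (Fin 2 → ℂ) :=
        { toFun := act u
          invFun := act (inv u)
          left_inv := fun z => (hinv u hu0 hu2 z).1
          right_inv := fun z => (hinv u hu0 hu2 z).2 }
      have hφ : φ ∈ equivariantAut G := (hshear φ).2 ⟨u, hu0, hu2, fun z => rfl⟩
      exact ⟨⟨φ, hφ⟩, hcu _ _ fun z => rfl⟩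
  have hopen : IsOpen (Set.range c) := hrange ▸ isOpen_setOf_mul_sub_mul_ne_zero _ _ _ _
  have hconn : IsConnected (Set.range c) := by
    rw [hrange]
    refine isConnected_setOf_mul_sub_mul_ne_zero _ _ _ _ ⟨c 1, ?_⟩
    have : c 1 ∈ Set.range c := ⟨1, rfl⟩
    rwa [hrange] at this
  have hcoord : ∀ i : Fin 3, ContDiff ℂ ω fun u : EuclideanSpace ℂ (Fin 3) => u i :=
    fun i => (f i).contDiff
  refine isConnectedLieGroup_of_coordinate c hopen hconn x R (fun φ => rfl) act ?_
    (fun φ => (hcact φ).2.2) inv ?_ ?_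
  · have hP : ∀ i, ContDiff ℂ ω fun q : EuclideanSpace ℂ (Fin 3) × (Fin 2 → ℂ) => P'.mulVec q.2 i := by
      intro i
      change ContDiff ℂ ω fun q : EuclideanSpace ℂ (Fin 3) × (Fin 2 → ℂ) => ∑ j, P' i j * q.2 j
      exact ContDiff.sum fun j _ => contDiff_const.mul ((contDiff_apply ℂ ℂ j).comp contDiff_snd)
    have hu : ∀ i, ContDiff ℂ ω fun q : EuclideanSpace ℂ (Fin 3) × (Fin 2 → ℂ) => q.1 i := fun i =>
      (hcoord i).comp contDiff_fst
    refine contDiff_pi.2 fun i => ?_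
    change ContDiff ℂ ω fun q : EuclideanSpace ℂ (Fin 3) × (Fin 2 → ℂ) => ∑ j, Q i j *
      ![q.1 0 * P'.mulVec q.2 0 + q.1 1 * P'.mulVec q.2 1 ^ v, q.1 2 * P'.mulVec q.2 1] j
    refine ContDiff.sum fun j _ => contDiff_const.mul ?_
    fin_cases j
    · exact ((hu 0).mul (hP 0)).add ((hu 1).mul ((hP 1).pow v))
    · exact (hu 2).mul (hP 1)
  · have hne : ∀ u ∈ Set.range c, u 0 ≠ 0 ∧ u 2 ≠ 0 := by
      rintro _ ⟨φ, rfl⟩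
      exact ⟨(hcact φ).1, (hcact φ).2.1⟩
    have h0 : ContDiffOn ℂ ω (fun u : EuclideanSpace ℂ (Fin 3) => (u 0)⁻¹) (Set.range c) :=
      (hcoord 0).contDiffOn.inv fun u hu => (hne u hu).1
    have h2 : ContDiffOn ℂ ω (fun u : EuclideanSpace ℂ (Fin 3) => (u 2)⁻¹) (Set.range c) :=
      (hcoord 2).contDiffOn.inv fun u hu => (hne u hu).2
    refine contDiffOn_euclidean.2 fun i => ?_
    fin_cases i
    · exact h0
    · exact ((h0.mul (hcoord 1).contDiffOn).mul (h2.pow v)).neg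
    · exact h2
  · intro φ
    refine hcu _ _ fun z => ?_
    obtain ⟨hu0, hu2, hu⟩ := hcact φ
    have h1 : (φ⁻¹).1 (φ.1 (act (inv (c φ)) z)) = act (inv (c φ)) z := φ.1.symm_apply_apply _
    rwa [hu, (hinv _ hu0 hu2 z).2] at h1

theorem mainTheorem6 :
    (∀ (k : Type*) [Field k] [CharZero k] (G : Subgroup (GL (Fin 2) k)),
      IsReductive G → ¬ IsCyclic G →
        equivariantAut G = equivariantGL G ∨
        (∃ v : ℕ, 2 ≤ v ∧ IsWeightedTorus G v) ∨
        IsWeightedTorus G 0) ∧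
    (∀ G : Subgroup (GL (Fin 2) ℂ), IsReductive G → ¬ IsCyclic G → IsConnectedLieGroup G) := by
  constructor
  · intro k _ _ G hG hcyc
    rcases hG.equivariantAut_eq_or_exists_weightedTorus hcyc with h | ⟨P, v, hv, h⟩
    · exact Or.inl h
    · right
      have ht := isWeightedTorus_of_map_conj_eq hv h
      rcases Nat.eq_zero_or_pos v with rfl | hpos
      · exact Or.inr ht
      · exact Or.inl ⟨v, by omega, ht⟩
  · intro G hG hcyc
    rcases hG.equivariantAut_eq_or_exists_weightedTorus hcyc with h | ⟨P, v, hv, h⟩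
    · exact isConnectedLieGroup_of_linear (h.le.trans inf_le_left)
    · exact isConnectedLieGroup_of_weightedTorus hv h
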